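/- **Setting.** Let $\mathcal X$ be a Polish space with its Borel $\sigma$-algebra, let $\mathcal Y$ be a finite set (discrete $\sigma$-algebra), let $2^{\mathcal Y}$ be the set of its subsets, and let $\ell:\mathcal Y\times\mathcal Y\to\mathbb R$ be a proper loss, i.e. $\ell\ge 0$ and $\ell(z,y)=0$ if and only if $z=y$. For a probability measure $\rho$ on $\mathcal X\times\mathcal Y$ and a measurable $f:\mathcal X\to\mathcal Y$ put $\mathcal R(f;\rho)=\mathbb E_{(X,Y)\sim\rho}[\ell(f(X),Y)]$. Let $L(z,S)=\inf_{y\in S}\ell(z,y)$ be the infimum loss. Let $\tau$ be a probability measure on $\mathcal X\times 2^{\mathcal Y}$. A probability measure $\rho$ on $\mathcal X\times\mathcal Y$ is eligible for $\tau$, written $\rho\vdash\tau$, if there is a probability measure $\pi$ on $\mathcal X\times\mathcal Y\times 2^{\mathcal Y}$ with marginals $\rho$ on $\mathcal X\times\mathcal Y$ and $\tau$ on $\mathcal X\times 2^{\mathcal Y}$ such that $\pi(\{(x,y,S): y\notin S\})=0$. Let $\tau|_x$ be the conditional distribution of the set given the input $x$. The measure $\tau$ is non-ambiguous if, for almost every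 $x$ (with respect to the marginal of $\tau$ on $\mathcal X$), the set $S_x=\bigcap_{S\in\operatorname{supp}(\tau|_x)}S$ is a singleton. Let $$\rho^\star\in\operatorname*{arg\,min}_{\rho\vdash\tau}\ \inf_{f}\mathcal R(f;\rho),\qquad f^*\in\operatorname*{arg\,min}_{f}\mathcal R(f;\rho^\star),$$ where $f$ ranges over the measurable functions $\mathcal X\to\mathcal Y$. Let $k:\mathcal X\times\mathcal X\to\mathbb R$ be a positive-definite kernel (all its Gram matrices are symmetric positive semidefinite). It is called universal if, for every Borel probability measure $\mu$ on $\mathcal X$, the linear span of $\{k(\cdot,x'):x'\in\mathcal X\}$ is dense in $L^2(\mu)$. Let $(x_i,S_i)_{i\ge1}$ be independent random variables with law $\tau$. For $n\ge 1$ let $\lambda=n^{-1/2}$, $K=(k(x_i,x_j))_{i,j\le n}$, $v(x)=(k(x,x_i))_{i\le n}$ and $\alpha(x)=(K+n\lambda I)^{-1}v(x)\in\mathbb R^n$, and let $f_n:\mathcal X\to\mathcal Y$ be any measurable function with $$f_n(x)\in\operatorname*{arg\,min}_{z\in\mathcal Y}\ \sum_{i=1}^n\alpha_i(x)\,L(z,S_i)=\operatorname*{arg\,min}_{z\in\mathcal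 Y}\ \sum_{i=1}^n\alpha_i(x)\inf_{y_i\in S_i}\ell(z,y_i)\qquad\text{for every }x\in\mathcal X.$$ **Theorem 3 (Consistency).** If $\mathcal Y$ is finite, $\tau$ is non-ambiguous and $k$ is a bounded continuous universal kernel (e.g. the Gaussian kernel on $\mathbb R^d$), then with probability $1$ $$\lim_{n\to\infty}\mathcal R(f_n;\rho^\star)=\mathcal R(f^*;\rho^\star).$$ -/

import Mathlib

open MeasureTheory ProbabilityTheory Filter Topology
open scoped ENNReal

namespace PartialLabelling

noncomputable section

/-- A loss is proper when it is non-negative and vanishes exactly on the diagonal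
(continuity is automatic on a finite discrete label space). -/
def ProperLoss {Y : Type*} (ℓ : Y → Y → ℝ) : Prop :=
  (∀ z y, 0 ≤ ℓ z y) ∧ ∀ z y, ℓ z y = 0 ↔ z = y

/-- The risk of a predictor `f` under a distribution `ρ` of input-label pairs. -/
def risk {X Y : Type*} [MeasurableSpace X] [MeasurableSpace Y]
    (ℓ : Y → Y → ℝ) (f : X → Y) (ρ : Measure (X × Y)) : ℝ :=
  ∫ p, ℓ (f p.1) p.2 ∂ρ

/-- `f` is a measurable minimizer of the risk under `ρ`. -/
def IsRiskMinimizer {X Y : Type*} [MeasurableSpace X] [MeasurableSpace Y]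
    (ℓ : Y → Y → ℝ) (ρ : Measure (X × Y)) (f : X → Y) : Prop :=
  Measurable f ∧ ∀ g : X → Y, Measurable g → risk ℓ f ρ ≤ risk ℓ g ρ

/-- The minimum risk (variability) of `ρ`: the infimum of the risk over measurable predictors. -/
def minRisk {X Y : Type*} [MeasurableSpace X] [MeasurableSpace Y]
    (ℓ : Y → Y → ℝ) (ρ : Measure (X × Y)) : ℝ :=
  ⨅ f : {f : X → Y // Measurable f}, risk ℓ f.1 ρ

/-- `ρ` is eligible for the weak distribution `τ`: both are marginals of one probability measure
on triples (input, label, set), under which the label lies in the set almost surely. -/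
def Eligible {X Y : Type*} [MeasurableSpace X] [MeasurableSpace Y]
    (ρ : Measure (X × Y)) (τ : Measure (X × Set Y)) : Prop :=
  ∃ π : Measure (X × Y × Set Y), IsProbabilityMeasure π ∧
    π.map (fun p => (p.1, p.2.1)) = ρ ∧
    π.map (fun p => (p.1, p.2.2)) = τ ∧
    π {p | p.2.1 ∉ p.2.2} = 0

/-- The minimum variability principle: `ρ` minimizes `minRisk` among the eligible distributions. -/
def IsMinVariability {X Y : Type*} [MeasurableSpace X] [MeasurableSpace Y]
    (ℓ : Y → Y → ℝ) (τ : Measure (X × Set Y)) (ρ : Measure (X × Y)) : Prop :=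
  Eligible ρ τ ∧ ∀ ρ' : Measure (X × Y), Eligible ρ' τ → minRisk ℓ ρ ≤ minRisk ℓ ρ'

/-- The intersection of all sets in the support of a distribution `ν` on the (finite, discrete)
space of subsets of `Y`; there the support is the set of atoms. -/
def supportInter {Y : Type*} [MeasurableSpace Y] (ν : Measure (Set Y)) : Set Y :=
  ⋂₀ {S : Set Y | ν {S} ≠ 0}

/-- Non-ambiguity: for almost every input `x`, the sets in the support of the conditional
distribution of `τ` given `x` have exactly one common element. (The conditional distribution is
determined up to null sets of inputs, and so is this property.) -/
def NonAmbiguous {X Y : Type*} [MeasurableSpace X] [MeasurableSpace Y] [Finite Y]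
    (τ : Measure (X × Set Y)) [IsFiniteMeasure τ] : Prop :=
  ∀ᵐ x ∂τ.fst, ∃ y : Y, supportInter (τ.condKernel x) = {y}

/-- A real positive-definite kernel: every Gram matrix is symmetric positive semidefinite. -/
def IsPosDefKernel {X : Type*} (k : X → X → ℝ) : Prop :=
  ∀ (m : ℕ) (x : Fin m → X), (Matrix.of fun i j => k (x i) (x j)).PosSemidef

/-- A bounded kernel. -/
def IsBoundedKernel {X : Type*} (k : X → X → ℝ) : Prop :=
  ∃ C : ℝ, ∀ x x', |k x x'| ≤ C

/-- A universal kernel: for every Borel probability measure `μ`, the functions spanned by the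
kernel sections `k(·, x')` are dense in `L²(μ)`. -/
def IsUniversalKernel {X : Type*} [MeasurableSpace X] (k : X → X → ℝ) : Prop :=
  ∀ μ : Measure X, IsProbabilityMeasure μ → ∀ h : X → ℝ, MemLp h 2 μ → ∀ ε : ℝ≥0∞, 0 < ε →
    ∃ g ∈ Submodule.span ℝ (Set.range fun (x' : X) (x : X) => k x x'), eLpNorm (h - g) 2 μ < ε

/-- On a compact space the classical notion of universality (uniform density of the span of the
kernel sections in the continuous functions) gives universality in the sense above. -/
theorem isUniversalKernel_of_uniform {X : Type*} [TopologicalSpace X] [PolishSpace X]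
    [CompactSpace X] [MeasurableSpace X] [BorelSpace X] (k : X → X → ℝ)
    (hk : Continuous (Function.uncurry k))
    (hu : ∀ f : C(X, ℝ), ∀ ε : ℝ, 0 < ε →
      ∃ g ∈ Submodule.span ℝ (Set.range fun (x' : X) (x : X) => k x x'), ∀ x, |f x - g x| ≤ ε) :
    IsUniversalKernel k := by
  have hcont : ∀ g ∈ Submodule.span ℝ (Set.range fun (x' : X) (x : X) => k x x'),
      Continuous g := by
    intro g hg
    induction hg using Submodule.span_induction with
    | mem g hg =>
      obtain ⟨x', rfl⟩ := hg
      exact hk.comp (continuous_id.prodMk continuous_const)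
    | zero => exact continuous_const
    | add _ _ _ _ h₁ h₂ => exact h₁.add h₂
    | smul c _ _ h => exact h.const_smul c
  intro μ hμ h hh ε hε
  let _ := TopologicalSpace.upgradeIsCompletelyMetrizable X
  obtain ⟨δ, hδ0, hδ⟩ := ENNReal.lt_iff_exists_nnreal_btwn.mp hε
  have hδ0' : (0 : ℝ) < δ := by exact_mod_cast hδ0
  have hhalf : (0 : ℝ) < δ / 2 := by positivity
  obtain ⟨c, hc, -⟩ := hh.exists_boundedContinuous_eLpNorm_sub_le (by norm_num)
    (ε := ENNReal.ofReal (δ / 2)) (by simpa using hδ0')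
  obtain ⟨g, hg, hgc⟩ := hu c.toContinuousMap (δ / 2) hhalf
  refine ⟨g, hg, lt_of_le_of_lt ?_ hδ⟩
  have h2 : eLpNorm (⇑c - g) 2 μ ≤ ENNReal.ofReal (δ / 2) := by
    refine (eLpNorm_le_of_ae_bound (C := δ / 2) (ae_of_all _ fun x => hgc x)).trans ?_
    simp
  have heq : h - g = (h - ⇑c) + (⇑c - g) := by simp
  rw [heq]
  calc eLpNorm ((h - ⇑c) + (⇑c - g)) 2 μ
      ≤ eLpNorm (h - ⇑c) 2 μ + eLpNorm (⇑c - g) 2 μ :=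
        eLpNorm_add_le (hh.1.sub c.continuous.aestronglyMeasurable)
          (c.continuous.sub (hcont g hg)).aestronglyMeasurable (by norm_num)
    _ ≤ ENNReal.ofReal (δ / 2) + ENNReal.ofReal (δ / 2) := add_le_add hc h2
    _ = δ := by
        rw [← ENNReal.ofReal_add hhalf.le hhalf.le, add_halves, ENNReal.ofReal_coe_nnreal]

/-- The infimum loss. -/
def infLoss {Y : Type*} (ℓ : Y → Y → ℝ) (z : Y) (S : Set Y) : ℝ :=
  ⨅ y : S, ℓ z y

/-- The kernel ridge regression weights `α(x) = (K + nλ)⁻¹ v(x)`. -/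
def ridgeWeights {X : Type*} (k : X → X → ℝ) (lam : ℝ) {n : ℕ} (xs : Fin n → X) (x : X) :
    Fin n → ℝ :=
  Matrix.mulVec
    ((Matrix.of fun i j => k (xs i) (xs j)) + ((n : ℝ) * lam) • (1 : Matrix (Fin n) (Fin n) ℝ))⁻¹
    (fun i => k x (xs i))

/-- The plug-in score of a label `z` at `x`: the integral of the infimum loss against the signed
measure `∑ αᵢ(x) δ_{Sᵢ}`. -/
def score {X Y : Type*} (ℓ : Y → Y → ℝ) (k : X → X → ℝ) (lam : ℝ) {n : ℕ}
    (data : Fin n → X × Set Y) (x : X) (z : Y) : ℝ :=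
  ∑ i, ridgeWeights k lam (fun j => (data j).1) x i * infLoss ℓ z (data i).2

/-- `f` is a (measurable) structured-prediction estimator trained on `data`: at every input it
minimizes the plug-in score. -/
def IsEstimator {X Y : Type*} [MeasurableSpace X] [MeasurableSpace Y]
    (ℓ : Y → Y → ℝ) (k : X → X → ℝ) (lam : ℝ) {n : ℕ}
    (data : Fin n → X × Set Y) (f : X → Y) : Prop :=
  Measurable f ∧ ∀ x z, score ℓ k lam data x (f x) ≤ score ℓ k lam data x z

end

end PartialLabelling

/-!
Strong consistency of the disambiguating kernel estimator, in three parts.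

**Regression.** For each label `z` the score is the kernel ridge regressor of the response
`L(z, S)` on the input. In the Hilbert space given by a feature map `Φ` of the kernel it is the
linear predictor `⟪w, Φ x⟫` whose vector `w` minimizes the regularized empirical square loss
(`exists_ridge_minimizer`). Comparison with the zero predictor gives `‖w‖ ≤ M n^{1/4}` for
`λ = n^{-1/2}`. The square loss of the *clipped* predictor is Lipschitz in `⟪w, Φ x⟫`, so that its
deviation from the expected loss, uniformly over that ball, is of order `n^{1/4} n^{-1/2}`.
Comparison with a fixed predictor, to which the strong law of large numbers applies and which by
universality is arbitrarily close to the regression function in `L²`, then shows that the clipped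
regressor converges almost surely in `L²` (`ae_tendsto_integral_clip_ridge`). Clipping is what makes
the rate `λ = n^{-1/2}` accessible: the unclipped square loss has uniform deviations of order one on
this ball.

**Uniform deviations.** `integral_posPartPow_deviation_le` bounds the sixth moment of the supremum
of the centred empirical process; the resulting bounds `O(n^{-3/2})` for the averages are summable,
which gives almost sure convergence without a concentration inequality for suprema. Symmetrization
and contraction are carried out one sample point at a time, with a convex function of a supremum
of sums in which the remaining terms are arbitrary. Each point contributes in the end a term
`±2L⟪w, Φ x⟫`, and these linear terms are merged into one vector; the sixth moment of its norm is
controlled by the Gaussian recursion `gaussSixth_average_le`.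

**Disambiguation.** If the sets possible at `x` have the single common label `y`, then the
conditional mean of `L(z, S)` vanishes for `z = y` and for no other `z`. Giving every input this
label is eligible with zero risk, so the distribution of minimum variability has zero risk as well
and coincides with that labelling, and `f*` is this label (`IsMinVariability.label_eq`). Clipping is
monotone, so the estimator still minimizes the clipped scores; since these converge to functions
with a unique zero, the probability of disagreeing with `f*` tends to zero
(`tendsto_measureReal_argmin_ne`), and the risk is at most a constant times this probability.
-/

namespace PartialLabelling

universe u

/-! ### Feature maps of positive-definite kernels -/

theorem IsPosDefKernel.symm {X : Type*} {k : X → X → ℝ} (hk : IsPosDefKernel k) (x y : X) :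
    k x y = k y x := by
  have h := (hk 2 ![x, y]).1
  have := congrFun (congrFun h 1) 0
  simpa using this

theorem IsPosDefKernel.finsupp_sum_nonneg {X : Type*} {k : X → X → ℝ} (hk : IsPosDefKernel k)
    (c : X →₀ ℝ) : 0 ≤ c.sum fun x a => c.sum fun y b => a * b * k y x := by
  classical
  let e := c.support.equivFin.symm
  have h := (hk c.support.card (fun i => (e i : X))).dotProduct_mulVec_nonneg
    (fun i => c (e i))
  have hs : ∀ F : X → ℝ, ∑ x ∈ c.support, F x = ∑ i, F (e i) := fun F => by
    rw [← Finset.sum_coe_sort c.support, ← e.sum_comp]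
  simp only [Finsupp.sum, hs]
  refine h.trans_eq ?_
  simp only [dotProduct, Matrix.mulVec, star_trivial, Finset.mul_sum, Pi.star_apply,
    Matrix.of_apply]
  refine Finset.sum_congr rfl fun i _ => Finset.sum_congr rfl fun j _ => ?_
  rw [hk.symm (e i : X)]
  ring

/-- The Moore–Aronszajn theorem for scalar kernels: a positive-definite kernel is the Gram matrix
of a feature map into a Hilbert space. -/
theorem IsPosDefKernel.exists_featureMap {X : Type u} {k : X → X → ℝ} (hk : IsPosDefKernel k) :
    ∃ (H : Type u) (_ : NormedAddCommGroup H) (_ : InnerProductSpace ℝ H) (Φ : X → H),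
      ∀ x y, inner ℝ (Φ x) (Φ y) = k x y := by
  let K : Matrix X X (ℝ →L[ℝ] ℝ) := Matrix.of fun x y => k x y • 1
  have hherm : K.IsHermitian := by
    ext x y
    simp [K, Matrix.conjTranspose_apply, hk.symm x y]
  have hK : K.PosSemidef := by
    have h := (RKHS.posSemidef_tfae (K := K)).out 0 2
    refine h.mpr ⟨hherm, fun c => ?_⟩
    refine (hk.finsupp_sum_nonneg c).trans_eq ?_
    simp [K, Finsupp.sum]
    refine Finset.sum_congr rfl fun i _ => Finset.sum_congr rfl fun j _ => ?_
    ring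
  have : Fact K.PosSemidef := ⟨hK⟩
  refine ⟨RKHS.OfKernel K, inferInstance, inferInstance, fun x => RKHS.kerFun (RKHS.OfKernel K) x 1,
    fun x y => ?_⟩
  rw [RKHS.kerFun_inner, RKHS.kerFun_apply, RKHS.OfKernel.kernel_ofKernel]
  simp [K]

/-! ### Kernel ridge regression as regularized least squares -/

/-- The kernel ridge regressor with weights `(K + nλ)⁻¹ v(x)` is linear in the feature `Φ x`, and
its coefficient vector minimizes the regularized empirical square loss. -/
theorem exists_ridge_minimizer {X H : Type*} [NormedAddCommGroup H] [InnerProductSpace ℝ H]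
    {k : X → X → ℝ} (hk : IsPosDefKernel k) {Φ : X → H} (hΦ : ∀ x y, inner ℝ (Φ x) (Φ y) = k x y)
    {n : ℕ} {lam : ℝ} (hlam : 0 < n * lam) (xs : Fin n → X) (b : Fin n → ℝ) :
    ∃ w : H, (∀ x, ∑ i, ridgeWeights k lam xs x i * b i = inner ℝ w (Φ x)) ∧
      w ∈ Submodule.span ℝ (Set.range Φ) ∧
      ∀ u : H, ∑ i, (inner ℝ w (Φ (xs i)) - b i) ^ 2 + n * lam * ‖w‖ ^ 2 ≤
        ∑ i, (inner ℝ u (Φ (xs i)) - b i) ^ 2 + n * lam * ‖u‖ ^ 2 := by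
  classical
  set K : Matrix (Fin n) (Fin n) ℝ := Matrix.of fun i j => k (xs i) (xs j) with hK
  set A : Matrix (Fin n) (Fin n) ℝ := K + ((n : ℝ) * lam) • (1 : Matrix (Fin n) (Fin n) ℝ) with hA
  have hKpsd : K.PosSemidef := hk n xs
  have hApd : A.PosDef := Matrix.PosDef.posSemidef_add hKpsd (Matrix.PosDef.one.smul hlam)
  have hdet : IsUnit A.det := (Matrix.isUnit_iff_isUnit_det A).mp hApd.isUnit
  have hAsymm : A⁻¹.transpose = A⁻¹ := by
    have := hApd.1.inv
    simpa [Matrix.IsHermitian, Matrix.conjTranspose_eq_transpose_of_trivial] using this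
  set c : Fin n → ℝ := A⁻¹.mulVec b with hc
  have hAc : A.mulVec c = b := by
    rw [hc, Matrix.mulVec_mulVec, Matrix.mul_nonsing_inv A hdet, Matrix.one_mulVec]
  set w : H := ∑ i, c i • Φ (xs i) with hw
  have hwΦ : ∀ x, inner ℝ w (Φ x) = ∑ i, c i * k (xs i) x := fun x => by
    simp [hw, sum_inner, inner_smul_left, hΦ]
  have hwu : ∀ u : H, inner ℝ w u = ∑ i, c i * inner ℝ u (Φ (xs i)) := fun u => by
    simp [hw, sum_inner, inner_smul_left, real_inner_comm]
  -- The normal equations: the residual at the `i`-th sample is `-nλ cᵢ`.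
  have hres : ∀ i, inner ℝ w (Φ (xs i)) - b i = -(n * lam * c i) := fun i => by
    have := congrFun hAc i
    rw [hA, Matrix.add_mulVec, Matrix.smul_mulVec, Matrix.one_mulVec] at this
    simp only [Pi.add_apply, Pi.smul_apply, smul_eq_mul] at this
    have h2 : K.mulVec c i = inner ℝ w (Φ (xs i)) := by
      rw [hwΦ]
      simp only [Matrix.mulVec, dotProduct, hK, Matrix.of_apply]
      exact Finset.sum_congr rfl fun j _ => by rw [hk.symm (xs i), mul_comm]
    linarith
  refine ⟨w, fun x => ?_, ?_, fun u => ?_⟩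
  · rw [hwΦ]
    have h1 : ∑ i, ridgeWeights k lam xs x i * b i = (A⁻¹.mulVec fun i => k x (xs i)) ⬝ᵥ b := rfl
    rw [h1, ← Matrix.vecMul_transpose, hAsymm, ← Matrix.dotProduct_mulVec, ← hc, dotProduct]
    exact Finset.sum_congr rfl fun j _ => by rw [hk.symm x, mul_comm]
  · exact Submodule.sum_mem _ fun i _ => Submodule.smul_mem _ _ (Submodule.subset_span ⟨_, rfl⟩)
  · set h := u - w with hh
    have hu : u = w + h := by simp [hh]
    have hcross : ∑ i, (inner ℝ h (Φ (xs i))) * (inner ℝ w (Φ (xs i)) - b i)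
        = -(n * lam * inner ℝ w h) := by
      rw [hwu, Finset.mul_sum, ← Finset.sum_neg_distrib]
      exact Finset.sum_congr rfl fun i _ => by rw [hres]; ring
    have hexp : ∑ i, (inner ℝ u (Φ (xs i)) - b i) ^ 2
        = ∑ i, (inner ℝ w (Φ (xs i)) - b i) ^ 2
          + 2 * ∑ i, (inner ℝ h (Φ (xs i))) * (inner ℝ w (Φ (xs i)) - b i)
          + ∑ i, (inner ℝ h (Φ (xs i))) ^ 2 := by
      rw [Finset.mul_sum, ← Finset.sum_add_distrib, ← Finset.sum_add_distrib]
      exact Finset.sum_congr rfl fun i _ => by rw [hu, inner_add_left]; ring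
    have hnorm : ‖u‖ ^ 2 = ‖w‖ ^ 2 + 2 * inner ℝ w h + ‖h‖ ^ 2 := by
      rw [hu, norm_add_sq_real]
    rw [hexp, hcross, hnorm]
    have h1 : 0 ≤ ∑ i, (inner ℝ h (Φ (xs i))) ^ 2 := Finset.sum_nonneg fun i _ => sq_nonneg _
    have h2 : 0 ≤ n * lam * ‖h‖ ^ 2 := by positivity
    linarith

/-! ### Contraction and the sixth moment of a supremum of centred sums -/

/-- The sixth power of the positive part. -/
noncomputable def posPartPow (u : ℝ) : ℝ := max u 0 ^ 6

theorem posPartPow_nonneg (u : ℝ) : 0 ≤ posPartPow u := by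
  unfold posPartPow; positivity

theorem posPartPow_mono : Monotone posPartPow := fun u v h => by
  unfold posPartPow
  gcongr

theorem posPartPow_convexOn : ConvexOn ℝ Set.univ posPartPow :=
  ((convexOn_id convex_univ).sup (convexOn_const 0 convex_univ)).pow (fun _ _ => le_max_right _ _) 6

theorem posPartPow_continuous : Continuous posPartPow := by
  unfold posPartPow; fun_prop

theorem posPartPow_le {u c : ℝ} (hc : 0 ≤ c) (h : u ≤ c) : posPartPow u ≤ c ^ 6 := by
  unfold posPartPow
  gcongr
  exact max_le h hc

/-- Convex nondecreasing functions respect weak majorization of pairs. -/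
theorem add_le_add_of_weak_majorization {F : ℝ → ℝ} (hF : ConvexOn ℝ Set.univ F)
    (hm : Monotone F) {x y p q : ℝ} (hx : x ≤ max p q) (hy : y ≤ max p q) (h : x + y ≤ p + q) :
    F x + F y ≤ F p + F q := by
  wlog hqp : q ≤ p generalizing p q
  · rw [add_comm (F p)]
    exact this (by rwa [max_comm]) (by rwa [max_comm]) (by linarith) (le_of_not_ge hqp)
  rw [max_eq_left hqp] at hx hy
  rcases le_or_gt x q with hxq | hxq
  · linarith [hm hxq, hm hy]
  have hd : 0 < p - q := by linarith
  set t := (x - q) / (p - q) with ht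
  have ht0 : 0 ≤ t := div_nonneg (by linarith) hd.le
  have ht1 : t ≤ 1 := (div_le_one hd).mpr (by linarith)
  have htd : t * (p - q) = x - q := div_mul_cancel₀ _ hd.ne'
  have h1 := hF.2 (Set.mem_univ p) (Set.mem_univ q) ht0 (sub_nonneg.mpr ht1) (by ring)
  have h2 := hF.2 (Set.mem_univ p) (Set.mem_univ q) (sub_nonneg.mpr ht1) ht0 (by ring)
  simp only [smul_eq_mul] at h1 h2
  rw [show t * p + (1 - t) * q = x by linarith] at h1
  have h3 := hm (show y ≤ (1 - t) * p + t * q by linarith)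
  linarith

theorem bddAbove_range_of_abs_le {ι : Type*} {a : ι → ℝ} {c : ℝ} (h : ∀ i, |a i| ≤ c) :
    BddAbove (Set.range a) :=
  ⟨c, by rintro _ ⟨i, rfl⟩; exact (le_abs_self _).trans (h i)⟩

theorem abs_ciSup_le {ι : Type*} [Nonempty ι] {a : ι → ℝ} {c : ℝ} (h : ∀ i, |a i| ≤ c) :
    |⨆ i, a i| ≤ c := by
  obtain ⟨i⟩ := ‹Nonempty ι›
  refine abs_le.mpr ⟨?_, ciSup_le fun j => (abs_le.mp (h j)).2⟩
  exact (abs_le.mp (h i)).1.trans (le_ciSup (bddAbove_range_of_abs_le h) i)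

/-- One step of the Ledoux–Talagrand contraction principle: averaged over a random sign, a
Lipschitz function vanishing at the origin may be replaced by its Lipschitz constant times the
identity, inside a convex nondecreasing function of a supremum. -/
theorem contraction_step {ι : Type*} [Nonempty ι] {F : ℝ → ℝ} (hF : ConvexOn ℝ Set.univ F)
    (hm : Monotone F) {A t : ι → ℝ} {a b L : ℝ} (hA : ∀ i, |A i| ≤ a) (ht : ∀ i, |t i| ≤ b)
    (hL : 0 ≤ L) {ψ : ℝ → ℝ} (hψ0 : ψ 0 = 0) (hψ : ∀ x y, |ψ x - ψ y| ≤ L * |x - y|) :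
    F (⨆ i, (A i + ψ (t i))) + F (⨆ i, (A i - ψ (t i))) ≤
      F (⨆ i, (A i + L * t i)) + F (⨆ i, (A i - L * t i)) := by
  have habs : ∀ i, |L * t i| ≤ L * b := fun i => by
    rw [abs_mul, abs_of_nonneg hL]
    exact mul_le_mul_of_nonneg_left (ht i) hL
  have hP : ∀ i, A i + L * t i ≤ ⨆ i, (A i + L * t i) := le_ciSup <|
    bddAbove_range_of_abs_le (c := a + L * b) fun i =>
      (abs_add_le _ _).trans (add_le_add (hA i) (habs i))
  have hQ : ∀ i, A i - L * t i ≤ ⨆ i, (A i - L * t i) := le_ciSup <|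
    bddAbove_range_of_abs_le (c := a + L * b) fun i =>
      (abs_sub _ _).trans (add_le_add (hA i) (habs i))
  set p := ⨆ i, (A i + L * t i)
  set q := ⨆ i, (A i - L * t i)
  have hψ' : ∀ x, |ψ x| ≤ L * |x| := fun x => by simpa [hψ0] using hψ x 0
  have hmax : ∀ i, A i + L * |t i| ≤ max p q := fun i => by
    rcases abs_cases (t i) with ⟨h, _⟩ | ⟨h, _⟩ <;> rw [h]
    · exact le_max_of_le_left (hP i)
    · exact le_max_of_le_right (by linarith [hQ i])
  refine add_le_add_of_weak_majorization hF hm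
    (ciSup_le fun i => ?_) (ciSup_le fun i => ?_) ?_
  · linarith [hmax i, (abs_le.mp (hψ' (t i))).2]
  · linarith [hmax i, (abs_le.mp (hψ' (t i))).1]
  · suffices ⨆ i, (A i + ψ (t i)) ≤ p + q - ⨆ i, (A i - ψ (t i)) by linarith
    refine ciSup_le fun i => ?_
    suffices ⨆ j, (A j - ψ (t j)) ≤ p + q - (A i + ψ (t i)) by linarith
    refine ciSup_le fun j => ?_
    have h1 := (abs_le.mp (hψ (t i) (t j))).2
    rcases abs_cases (t i - t j) with ⟨h, _⟩ | ⟨h, _⟩ <;> rw [h] at h1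
    · linarith [hP i, hQ j]
    · linarith [hP j, hQ i]

theorem integrable_of_abs_le {D : Type*} [MeasurableSpace D] {ν : Measure D} [IsFiniteMeasure ν]
    {f : D → ℝ} (hf : Measurable f) {c : ℝ} (hc : ∀ d, |f d| ≤ c) : Integrable f ν :=
  Integrable.of_bound hf.aestronglyMeasurable c (ae_of_all _ hc)

theorem abs_posPartPow_iSup_le {ι : Type*} [Nonempty ι] {a : ι → ℝ} {c : ℝ} (h : ∀ i, |a i| ≤ c) :
    |posPartPow (⨆ i, a i)| ≤ c ^ 6 := by
  have hc : 0 ≤ c := (abs_nonneg _).trans (h (Classical.arbitrary ι))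
  rw [abs_of_nonneg (posPartPow_nonneg _)]
  exact posPartPow_le hc ((le_abs_self _).trans (abs_ciSup_le h))

theorem measurable_posPartPow_iSup {ι D : Type*} [Countable ι] [MeasurableSpace D]
    {f : ι → D → ℝ} (hf : ∀ i, Measurable (f i)) :
    Measurable fun d => posPartPow (⨆ i, f i d) :=
  posPartPow_continuous.measurable.comp (Measurable.iSup hf)

theorem integrable_posPartPow_iSup {ι D : Type*} [Countable ι] [Nonempty ι] [MeasurableSpace D]
    {ν : Measure D} [IsFiniteMeasure ν] {f : ι → D → ℝ} (hf : ∀ i, Measurable (f i)) {c : ℝ}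
    (hc : ∀ i d, |f i d| ≤ c) : Integrable (fun d => posPartPow (⨆ i, f i d)) ν :=
  integrable_of_abs_le (measurable_posPartPow_iSup hf)
    fun d => abs_posPartPow_iSup_le fun i => hc i d

/-- Symmetrization and contraction of a single summand. Centring is removed by convexity,
`A + 𝔼g - g = ((A + 2𝔼g) + (A - 2g)) / 2`, and by Jensen's inequality for the expectation. -/
theorem integral_posPartPow_centred_le {ι D : Type*} [Countable ι] [Nonempty ι] [MeasurableSpace D]
    {ν : Measure D} [IsProbabilityMeasure ν] {A : ι → ℝ} {a b L : ℝ} (hA : ∀ i, |A i| ≤ a)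
    {t : ι → D → ℝ} (ht : ∀ i d, |t i d| ≤ b) (htm : ∀ i, Measurable (t i)) (hL : 0 ≤ L)
    {ψ : D → ℝ → ℝ} (hψ0 : ∀ d, ψ d 0 = 0) (hψ : ∀ d x y, |ψ d x - ψ d y| ≤ L * |x - y|)
    (hψm : ∀ i, Measurable fun d => ψ d (t i d)) :
    ∫ d, posPartPow (⨆ i, (A i + (∫ d', ψ d' (t i d') ∂ν - ψ d (t i d)))) ∂ν ≤
      ∫ d, (posPartPow (⨆ i, (A i + 2 * L * t i d)) +
        posPartPow (⨆ i, (A i - 2 * L * t i d))) / 2 ∂ν := by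
  set g : ι → D → ℝ := fun i d => ψ d (t i d) with hg
  have hgb : ∀ i d, |g i d| ≤ L * b := fun i d => by
    have := hψ d (t i d) 0
    rw [hψ0, sub_zero, sub_zero] at this
    exact this.trans (mul_le_mul_of_nonneg_left (ht i d) hL)
  have hgi : ∀ i, Integrable (g i) ν := fun i => integrable_of_abs_le (hψm i) (hgb i)
  have hEb : ∀ i, |∫ d, g i d ∂ν| ≤ L * b := fun i => by
    have := norm_integral_le_of_norm_le_const (μ := ν) (f := g i) (C := L * b) (ae_of_all _ (hgb i))
    simpa using this
  have hAm : ∀ (s : ℝ) (x : ι → ℝ), (∀ i, |x i| ≤ L * b) → |s| ≤ 2 → ∀ i,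
      |A i + s * x i| ≤ a + 2 * (L * b) := fun s x hx hs i => by
    refine (abs_add_le _ _).trans (add_le_add (hA i) ?_)
    rw [abs_mul]
    exact mul_le_mul hs (hx i) (abs_nonneg _) (by norm_num)
  have hint : ∀ s : ℝ, |s| ≤ 2 → ∀ x : ι → D → ℝ, (∀ i d, |x i d| ≤ L * b) →
      (∀ i, Measurable (x i)) → Integrable (fun d => posPartPow (⨆ i, (A i + s * x i d))) ν :=
    fun s hs x hx hxm => integrable_posPartPow_iSup
      (fun i => ((hxm i).const_mul s).const_add _) fun i d => hAm s (x · d) (hx · d) hs i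
  have hLt : ∀ i d, |L * t i d| ≤ L * b := fun i d => by
    rw [abs_mul, abs_of_nonneg hL]; exact mul_le_mul_of_nonneg_left (ht i d) hL
  have hgp := hint 2 (by norm_num) g hgb hψm
  have hgn := hint (-2) (by norm_num) g hgb hψm
  have htp := hint 2 (by norm_num) (fun i d => L * t i d) hLt fun i => (htm i).const_mul L
  have htn := hint (-2) (by norm_num) (fun i d => L * t i d) hLt fun i => (htm i).const_mul L
  have hbdd : ∀ (s : ℝ) (x : ι → ℝ), (∀ i, |x i| ≤ L * b) → |s| ≤ 2 →
      BddAbove (Set.range fun i => A i + s * x i) :=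
    fun s x hx hs => bddAbove_range_of_abs_le (hAm s x hx hs)
  -- Jensen's inequality for the centring term
  have hjensen : posPartPow (⨆ i, (A i + 2 * ∫ d, g i d ∂ν)) ≤
      ∫ d, posPartPow (⨆ i, (A i + 2 * g i d)) ∂ν := by
    have hsupi : Integrable (fun d => ⨆ i, (A i + 2 * g i d)) ν :=
      integrable_of_abs_le (Measurable.iSup fun i => ((hψm i).const_mul 2).const_add _)
        (c := a + 2 * (L * b)) fun d => abs_ciSup_le (hAm 2 (g · d) (hgb · d) (by norm_num))
    have h1 : ⨆ i, (A i + 2 * ∫ d, g i d ∂ν) ≤ ∫ d, ⨆ i, (A i + 2 * g i d) ∂ν := by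
      refine ciSup_le fun i => ?_
      have : A i + 2 * ∫ d, g i d ∂ν = ∫ d, (A i + 2 * g i d) ∂ν := by
        rw [integral_add (integrable_const _) ((hgi i).const_mul 2), integral_const_mul]
        simp
      rw [this]
      exact integral_mono ((integrable_const _).add ((hgi i).const_mul 2)) hsupi
        fun d => le_ciSup (hbdd 2 (g · d) (hgb · d) (by norm_num)) i
    exact (posPartPow_mono h1).trans <| posPartPow_convexOn.map_integral_le
      posPartPow_continuous.continuousOn isClosed_univ (ae_of_all _ fun _ => Set.mem_univ _)
      hsupi hgp
  have hsplit : ∀ d, posPartPow (⨆ i, (A i + (∫ d', g i d' ∂ν - g i d))) ≤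
      (posPartPow (⨆ i, (A i + 2 * ∫ d', g i d' ∂ν)) +
        posPartPow (⨆ i, (A i + -2 * g i d))) / 2 := fun d => by
    have h1 : ⨆ i, (A i + (∫ d', g i d' ∂ν - g i d)) ≤
        (1 / 2 : ℝ) * (⨆ i, (A i + 2 * ∫ d', g i d' ∂ν)) +
          (1 / 2 : ℝ) * ⨆ i, (A i + -2 * g i d) := by
      refine ciSup_le fun i => ?_
      have h2 := le_ciSup (hbdd 2 (fun i => ∫ d', g i d' ∂ν) hEb (by norm_num)) i
      have h3 := le_ciSup (hbdd (-2) (g · d) (hgb · d) (by norm_num)) i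
      linarith
    refine (posPartPow_mono h1).trans ?_
    have := posPartPow_convexOn.2 (Set.mem_univ (⨆ i, (A i + 2 * ∫ d', g i d' ∂ν)))
      (Set.mem_univ (⨆ i, (A i + -2 * g i d))) (by norm_num : (0 : ℝ) ≤ 1 / 2)
      (by norm_num : (0 : ℝ) ≤ 1 / 2) (by norm_num)
    simp only [smul_eq_mul] at this
    linarith
  have hcontr : ∀ d, posPartPow (⨆ i, (A i + 2 * g i d)) + posPartPow (⨆ i, (A i + -2 * g i d)) ≤
      posPartPow (⨆ i, (A i + 2 * (L * t i d))) + posPartPow (⨆ i, (A i + -2 * (L * t i d))) :=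
    fun d => by
    have := contraction_step posPartPow_convexOn posPartPow_mono hA (fun i => ht i d)
      (L := 2 * L) (by positivity) (ψ := fun x => 2 * ψ d x) (by simp [hψ0]) (fun x y => by
        rw [← mul_sub, abs_mul, abs_two, mul_assoc]
        exact mul_le_mul_of_nonneg_left (hψ d x y) (by norm_num))
    simpa only [neg_mul, ← sub_eq_add_neg, mul_assoc] using this
  have hleft : Integrable (fun d => posPartPow (⨆ i, (A i + (∫ d', g i d' ∂ν - g i d)))) ν :=
    integrable_posPartPow_iSup (c := a + (L * b + L * b))
      (fun i => ((hψm i).const_sub _).const_add _) fun i d =>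
      (abs_add_le _ _).trans (add_le_add (hA i)
        ((abs_sub _ _).trans (add_le_add (hEb i) (hgb i d))))
  calc ∫ d, posPartPow (⨆ i, (A i + (∫ d', g i d' ∂ν - g i d))) ∂ν
      ≤ ∫ d, (posPartPow (⨆ i, (A i + 2 * ∫ d', g i d' ∂ν)) +
          posPartPow (⨆ i, (A i + -2 * g i d))) / 2 ∂ν :=
        integral_mono hleft (((integrable_const _).add hgn).div_const 2) hsplit
    _ = (posPartPow (⨆ i, (A i + 2 * ∫ d', g i d' ∂ν)) +
          ∫ d, posPartPow (⨆ i, (A i + -2 * g i d)) ∂ν) / 2 := by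
        rw [integral_div, integral_add (integrable_const _) hgn]
        simp
    _ ≤ (∫ d, posPartPow (⨆ i, (A i + 2 * g i d)) ∂ν +
          ∫ d, posPartPow (⨆ i, (A i + -2 * g i d)) ∂ν) / 2 := by linarith [hjensen]
    _ = ∫ d, (posPartPow (⨆ i, (A i + 2 * g i d)) +
          posPartPow (⨆ i, (A i + -2 * g i d))) / 2 ∂ν := by
        rw [integral_div, integral_add hgp hgn]
    _ ≤ ∫ d, (posPartPow (⨆ i, (A i + 2 * (L * t i d))) +
          posPartPow (⨆ i, (A i + -2 * (L * t i d)))) / 2 ∂ν := by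
        refine integral_mono ((hgp.add hgn).div_const 2) ((htp.add htn).div_const 2) fun d => ?_
        exact div_le_div_of_nonneg_right (hcontr d) (by norm_num)
    _ = _ := by simp only [neg_mul, ← sub_eq_add_neg, mul_assoc]

/-- The sixth moment `a⁶ + 15 s a⁴ + 45 s² a² + 15 s³` of a Gaussian with mean `a` and
variance `s`. -/
def gaussSixth (s a : ℝ) : ℝ := a ^ 6 + 15 * s * a ^ 4 + 45 * s ^ 2 * a ^ 2 + 15 * s ^ 3

theorem gaussSixth_average_le {H : Type*} [NormedAddCommGroup H] [InnerProductSpace ℝ H]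
    {s β : ℝ} (hs : 0 ≤ s) (v u : H) (hu : ‖u‖ ≤ β) :
    (gaussSixth s ‖v + u‖ + gaussSixth s ‖v - u‖) / 2 ≤ gaussSixth (s + β ^ 2) ‖v‖ := by
  have hβ : 0 ≤ β := (norm_nonneg u).trans hu
  set c := inner ℝ v u with hc
  set a := ‖v‖ ^ 2 with ha
  set r := ‖u‖ ^ 2 with hr
  have hp : ‖v + u‖ ^ 2 = a + r + 2 * c := by rw [norm_add_sq_real]; ring
  have hm : ‖v - u‖ ^ 2 = a + r - 2 * c := by rw [norm_sub_sq_real]; ring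
  have hg : ∀ s x : ℝ, gaussSixth s x = (x ^ 2) ^ 3 + 15 * s * (x ^ 2) ^ 2
      + 45 * s ^ 2 * x ^ 2 + 15 * s ^ 3 := fun s x => by unfold gaussSixth; ring
  have ha0 : 0 ≤ a := sq_nonneg _
  have hr0 : 0 ≤ r := sq_nonneg _
  have hcs : c ^ 2 ≤ a * r := by
    rw [ha, hr, ← mul_pow, ← sq_abs c]
    exact pow_le_pow_left₀ (abs_nonneg _) (abs_real_inner_le_norm v u) 2
  have hrβ : r ≤ β ^ 2 := pow_le_pow_left₀ (norm_nonneg u) hu 2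
  rw [hg, hg, hg, hp, hm]
  have h1 : c ^ 2 * (12 * (a + r) + 60 * s) ≤ a * r * (12 * (a + r) + 60 * s) :=
    mul_le_mul_of_nonneg_right hcs (by positivity)
  -- Monotonicity in `r` reduces to `r = β²`; what remains is a sum of nonnegative terms.
  have h2 : a ^ 3 + 15 * (s + r) * a ^ 2 + 45 * (s + r) ^ 2 * a + 15 * (s + r) ^ 3 ≤
      a ^ 3 + 15 * (s + β ^ 2) * a ^ 2 + 45 * (s + β ^ 2) ^ 2 * a + 15 * (s + β ^ 2) ^ 3 := by
    gcongr
  have h3 : 0 ≤ 30 * r ^ 2 * a + 30 * s * r ^ 2 + 14 * r ^ 3 := by positivity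
  nlinarith [h1, h2, h3]

/-- The sixth moment of the positive part of the uniform deviation `∑ⱼ (𝔼 ψ - ψⱼ)` over a family
of linear predictors
`d ↦ ⟪wᵢ, Φ d⟫` of norm at most `B`, shifted by a linear functional `⟪wᵢ, v⟫`. The summands are
replaced one by one by `±2L⟪wᵢ, Φ dⱼ⟫`, which are absorbed in the linear functional. -/
theorem integral_posPartPow_deviation_le {ι D H : Type*} [Countable ι] [Nonempty ι]
    [MeasurableSpace D] [NormedAddCommGroup H] [InnerProductSpace ℝ H]
    (ν : Measure D) [IsProbabilityMeasure ν] {w : ι → H} {B : ℝ} (hB : ∀ i, ‖w i‖ ≤ B)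
    {Φ : D → H} {κ : ℝ} (hΦ : ∀ d, ‖Φ d‖ ≤ κ) (hΦm : ∀ u, Measurable fun d => inner ℝ u (Φ d))
    {L : ℝ} (hL : 0 ≤ L) {ψ : D → ℝ → ℝ} (hψ0 : ∀ d, ψ d 0 = 0)
    (hψ : ∀ d x y, |ψ d x - ψ d y| ≤ L * |x - y|)
    (hψm : ∀ i, Measurable fun d => ψ d (inner ℝ (w i) (Φ d))) (n : ℕ) (v : H) :
    ∫ d : Fin n → D, posPartPow (⨆ i, (inner ℝ (w i) v +
        ∑ j, (∫ d', ψ d' (inner ℝ (w i) (Φ d')) ∂ν - ψ (d j) (inner ℝ (w i) (Φ (d j))))))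
      ∂(Measure.pi fun _ => ν) ≤ B ^ 6 * gaussSixth (n * (2 * L * κ) ^ 2) ‖v‖ := by
  have hB0 : 0 ≤ B := (norm_nonneg _).trans (hB (Classical.arbitrary ι))
  have hinner : ∀ i (u : H), |inner ℝ (w i) u| ≤ B * ‖u‖ := fun i u =>
    (abs_real_inner_le_norm _ _).trans (mul_le_mul_of_nonneg_right (hB i) (norm_nonneg _))
  have htb : ∀ i d, |inner ℝ (w i) (Φ d)| ≤ B * κ := fun i d =>
    (hinner i _).trans (mul_le_mul_of_nonneg_left (hΦ d) hB0)
  set g : ι → D → ℝ := fun i d => ∫ d', ψ d' (inner ℝ (w i) (Φ d')) ∂ν - ψ d (inner ℝ (w i) (Φ d))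
    with hg
  have hgm : ∀ i, Measurable (g i) := fun i => (hψm i).const_sub _
  have hψb : ∀ i d, |ψ d (inner ℝ (w i) (Φ d))| ≤ L * (B * κ) := fun i d => by
    have := hψ d (inner ℝ (w i) (Φ d)) 0
    rw [hψ0, sub_zero, sub_zero] at this
    exact this.trans (mul_le_mul_of_nonneg_left (htb i d) hL)
  have hgb : ∀ i d, |g i d| ≤ 2 * (L * (B * κ)) := fun i d => by
    have := norm_integral_le_of_norm_le_const (μ := ν)
      (f := fun d => ψ d (inner ℝ (w i) (Φ d))) (C := L * (B * κ)) (ae_of_all _ (hψb i))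
    rw [two_mul]
    exact (abs_sub _ _).trans (add_le_add (by simpa using this) (hψb i d))
  have hsumb : ∀ n (d : Fin n → D) i, |∑ j, g i (d j)| ≤ n * (2 * (L * (B * κ))) := fun n d i => by
    refine (Finset.abs_sum_le_sum_abs _ _).trans ?_
    refine (Finset.sum_le_sum fun j _ => hgb i (d j)).trans_eq ?_
    simp
  induction n generalizing v with
  | zero =>
    have : ⨆ i, inner ℝ (w i) v ≤ B * ‖v‖ := ciSup_le fun i => (le_abs_self _).trans (hinner i v)
    have h2 := posPartPow_le (by positivity) this
    simpa [gaussSixth, mul_pow] using h2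
  | succ n ih =>
    set σ : Measure (Fin n → D) := Measure.pi fun _ => ν with hσ
    let Θ : H → (Fin n → D) → ℝ := fun v d => posPartPow (⨆ i, (inner ℝ (w i) v + ∑ j, g i (d j)))
    have hmp := measurePreserving_piFinSuccAbove (fun _ : Fin (n + 1) => ν) 0
    have hstep1 : ∫ d : Fin (n + 1) → D, posPartPow (⨆ i, (inner ℝ (w i) v + ∑ j, g i (d j)))
          ∂(Measure.pi fun _ => ν) =
        ∫ p : D × (Fin n → D), posPartPow (⨆ i, ((inner ℝ (w i) v + ∑ j, g i (p.2 j)) + g i p.1))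
          ∂(ν.prod σ) := by
      rw [← hmp.integral_comp (MeasurableEquiv.measurableEmbedding _)]
      refine integral_congr_ae (ae_of_all _ fun d => ?_)
      simp only [MeasurableEquiv.piFinSuccAbove_apply, Fin.insertNthEquiv_symm_apply,
        Fin.sum_univ_succ, Fin.removeNth, Fin.zero_succAbove]
      congr 1
      exact iSup_congr fun i => by ring
    have hmeas : ∀ i, Measurable fun d : Fin n → D => ∑ j, g i (d j) := fun i =>
      Finset.measurable_sum _ fun j _ => (hgm i).comp (measurable_pi_apply j)
    have hshift : ∀ (d : Fin n → D) i, |inner ℝ (w i) v + ∑ j, g i (d j)| ≤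
        B * ‖v‖ + n * (2 * (L * (B * κ))) := fun d i =>
      (abs_add_le _ _).trans (add_le_add (hinner i v) (hsumb n d i))
    have hint1 : Integrable (fun p : D × (Fin n → D) =>
        posPartPow (⨆ i, ((inner ℝ (w i) v + ∑ j, g i (p.2 j)) + g i p.1))) (ν.prod σ) :=
      integrable_posPartPow_iSup (fun i => (((hmeas i).comp measurable_snd).const_add _).add
        ((hgm i).comp measurable_fst)) fun i p =>
        (abs_add_le _ _).trans (add_le_add (hshift p.2 i) (hgb i p.1))
    have hΦn : ∀ (s : ℝ), |s| ≤ 2 * L → ∀ i x, |inner ℝ (w i) (s • Φ x)| ≤ 2 * L * (B * κ) :=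
      fun s hs i x => by
        rw [inner_smul_right, abs_mul]
        exact mul_le_mul hs (htb i x) (abs_nonneg _) (by positivity)
    have hintΘ : ∀ s : ℝ, |s| ≤ 2 * L →
        Integrable (fun p : D × (Fin n → D) => Θ (v + s • Φ p.1) p.2) (ν.prod σ) := fun s hs => by
      refine integrable_posPartPow_iSup (c := (B * ‖v‖ + 2 * L * (B * κ)) + n * (2 * (L * (B * κ))))
        (f := fun i (p : D × (Fin n → D)) => inner ℝ (w i) (v + s • Φ p.1) + ∑ j, g i (p.2 j))
        (fun i => ?_) fun i p => ?_
      · refine Measurable.add ?_ ((hmeas i).comp measurable_snd)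
        simp only [inner_add_right, inner_smul_right]
        exact (((hΦm (w i)).comp measurable_fst).const_mul s).const_add _
      · refine (abs_add_le _ _).trans (add_le_add ?_ (hsumb n p.2 i))
        rw [inner_add_right]
        exact (abs_add_le _ _).trans (add_le_add (hinner i v) (hΦn s hs i p.1))
    have hs2 : |2 * L| ≤ 2 * L := (abs_of_nonneg (by positivity)).le
    have hs2' : |-(2 * L)| ≤ 2 * L := (abs_neg _).trans_le hs2
    have hintavg : Integrable (fun p : D × (Fin n → D) =>
        (Θ (v + (2 * L) • Φ p.1) p.2 + Θ (v + (-(2 * L)) • Φ p.1) p.2) / 2) (ν.prod σ) :=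
      ((hintΘ _ hs2).add (hintΘ _ hs2')).div_const 2
    change ∫ d : Fin (n + 1) → D, posPartPow (⨆ i, (inner ℝ (w i) v + ∑ j, g i (d j)))
          ∂(Measure.pi fun _ => ν) ≤ _
    rw [hstep1]
    calc ∫ p : D × (Fin n → D), posPartPow (⨆ i, ((inner ℝ (w i) v + ∑ j, g i (p.2 j)) + g i p.1))
          ∂(ν.prod σ)
        = ∫ d, ∫ x, posPartPow (⨆ i, ((inner ℝ (w i) v + ∑ j, g i (d j)) + g i x)) ∂ν ∂σ :=
          integral_prod_symm _ hint1
      _ ≤ ∫ d, ∫ x, (Θ (v + (2 * L) • Φ x) d + Θ (v + (-(2 * L)) • Φ x) d) / 2 ∂ν ∂σ := by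
          refine integral_mono hint1.integral_prod_right hintavg.integral_prod_right fun d => ?_
          refine (integral_posPartPow_centred_le (hshift d) htb (fun i => hΦm (w i)) hL hψ0 hψ
            hψm).trans_eq (integral_congr_ae (ae_of_all _ fun x => ?_))
          have hp : ∀ s : ℝ, Θ (v + s • Φ x) d = posPartPow (⨆ i, (inner ℝ (w i) v +
              ∑ j, g i (d j) + s * inner ℝ (w i) (Φ x))) := fun s =>
            congrArg posPartPow <| iSup_congr fun i => by
              rw [inner_add_right, inner_smul_right]; ring
          simp only [hp, neg_mul, ← sub_eq_add_neg]
      _ = ∫ x, ∫ d, (Θ (v + (2 * L) • Φ x) d + Θ (v + (-(2 * L)) • Φ x) d) / 2 ∂σ ∂ν := by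
          rw [← integral_prod_symm _ hintavg, integral_prod _ hintavg]
      _ ≤ ∫ _, B ^ 6 * gaussSixth ((n + 1 : ℕ) * (2 * L * κ) ^ 2) ‖v‖ ∂ν := by
          refine integral_mono hintavg.integral_prod_left (integrable_const _) fun x => ?_
          have hΘi : ∀ u, Integrable (Θ u) σ := fun u =>
            integrable_posPartPow_iSup (fun i => (hmeas i).const_add _) fun i d =>
              (abs_add_le _ _).trans (add_le_add (hinner i u) (hsumb n d i))
          simp only
          rw [integral_div, integral_add (hΘi _) (hΘi _)]
          have hu : ‖(2 * L) • Φ x‖ ≤ 2 * L * κ := by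
            rw [norm_smul, Real.norm_of_nonneg (by positivity)]
            exact mul_le_mul_of_nonneg_left (hΦ x) (by positivity)
          have h1 := ih (v + (2 * L) • Φ x)
          have h2 := ih (v + (-(2 * L)) • Φ x)
          rw [neg_smul, ← sub_eq_add_neg] at h2 ⊢
          have h3 := mul_le_mul_of_nonneg_left (gaussSixth_average_le
            (s := n * (2 * L * κ) ^ 2) (by positivity) v _ hu) (pow_nonneg hB0 6)
          rw [Nat.cast_succ, add_one_mul]
          refine le_trans ?_ h3
          rw [mul_div_assoc', mul_add]
          exact div_le_div_of_nonneg_right (add_le_add h1 h2) (by norm_num)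
      _ = _ := by simp

/-! ### Almost sure uniform deviations over balls of radius `n^{1/4}` -/

theorem ae_tendsto_zero_of_summable {Ω : Type*} [MeasurableSpace Ω] {P : Measure Ω}
    {f : ℕ → Ω → ℝ} (hf : ∀ n, AEMeasurable (f n) P) (h0 : ∀ n ω, 0 ≤ f n ω) {c : ℕ → ℝ}
    (hc : Summable c) (hfc : ∀ n, ∫⁻ ω, ENNReal.ofReal (f n ω) ∂P ≤ ENNReal.ofReal (c n)) :
    ∀ᵐ ω ∂P, Tendsto (fun n => f n ω) atTop (𝓝 0) := by
  have hsum : ∫⁻ ω, ∑' n, ENNReal.ofReal (f n ω) ∂P ≠ ∞ := by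
    rw [lintegral_tsum fun n => (hf n).ennreal_ofReal]
    exact ne_top_of_le_ne_top hc.tsum_ofReal_ne_top (ENNReal.tsum_le_tsum hfc)
  filter_upwards [ae_lt_top' (AEMeasurable.tsum fun n => (hf n).ennreal_ofReal) hsum]
    with ω hω
  have h1 := ENNReal.tendsto_atTop_zero_of_tsum_ne_top hω.ne
  have h2 := (ENNReal.tendsto_toReal ENNReal.zero_ne_top).comp h1
  refine (h2.congr fun n => ?_)
  simp [ENNReal.toReal_ofReal (h0 n ω)]

theorem exists_dense_seq_ball {X H : Type*} [TopologicalSpace X] [TopologicalSpace.SeparableSpace X]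
    [NormedAddCommGroup H] [InnerProductSpace ℝ H] {Φ : X → H} (hΦ : Continuous Φ) {B : ℝ}
    (hB : 0 ≤ B) :
    ∃ w : ℕ → H, (∀ i, ‖w i‖ ≤ B) ∧
      ∀ u ∈ Submodule.span ℝ (Set.range Φ), ‖u‖ ≤ B → u ∈ closure (Set.range w) := by
  have hsep : TopologicalSpace.IsSeparable (Submodule.span ℝ (Set.range Φ) : Set H) :=
    (TopologicalSpace.isSeparable_range hΦ).span
  obtain ⟨t, hts, htc, hst⟩ := (hsep.mono
    (Set.inter_subset_left (t := {u | ‖u‖ ≤ B}))).exists_countable_dense_subset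
  have hne : t.Nonempty := by
    by_contra h
    rw [Set.not_nonempty_iff_eq_empty] at h
    have : (0 : H) ∈ closure t := hst ⟨Submodule.zero_mem _, by simpa using hB⟩
    simp [h] at this
  obtain ⟨w, rfl⟩ := htc.exists_eq_range hne
  exact ⟨w, fun i => (hts ⟨i, rfl⟩).2, fun u hu huB => hst ⟨hu, huB⟩⟩

theorem map_sample_eq_pi {Ω D : Type*} [MeasurableSpace Ω] [MeasurableSpace D] {P : Measure Ω}
    [IsProbabilityMeasure P] {ν : Measure D} {Z : ℕ → Ω → D} (hZ : ∀ i, HasLaw (Z i) ν P)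
    (hind : iIndepFun Z P) (n : ℕ) :
    P.map (fun ω (j : Fin n) => Z j ω) = Measure.pi fun _ => ν := by
  have h := (hind.precomp (g := ((↑) : Fin n → ℕ)) Fin.val_injective)
  have h2 := (iIndepFun_iff_map_fun_eq_pi_map fun j : Fin n => (hZ j).aemeasurable).mp h
  rw [h2]
  exact congrArg Measure.pi (funext fun j => (hZ j).map_eq)

/-- Lipschitz dependence of an expected loss on the linear predictor. -/
theorem continuous_integral_inner {D H : Type*} [MeasurableSpace D] [NormedAddCommGroup H]
    [InnerProductSpace ℝ H] {ν : Measure D} [IsProbabilityMeasure ν] {Φ : D → H} {κ : ℝ}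
    (hΦ : ∀ d, ‖Φ d‖ ≤ κ) {L : ℝ} (hL : 0 ≤ L) {ψ : D → ℝ → ℝ} (hψ0 : ∀ d, ψ d 0 = 0)
    (hψ : ∀ d x y, |ψ d x - ψ d y| ≤ L * |x - y|)
    (hψm : ∀ u, Measurable fun d => ψ d (inner ℝ u (Φ d))) :
    Continuous fun u => ∫ d, ψ d (inner ℝ u (Φ d)) ∂ν := by
  have hdiff : ∀ d u u', |ψ d (inner ℝ u (Φ d)) - ψ d (inner ℝ u' (Φ d))| ≤
      L * κ * ‖u - u'‖ := fun d u u' => by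
    refine (hψ d _ _).trans ?_
    rw [← inner_sub_left, mul_assoc]
    refine mul_le_mul_of_nonneg_left ((abs_real_inner_le_norm _ _).trans ?_) hL
    rw [mul_comm κ]
    exact mul_le_mul_of_nonneg_left (hΦ d) (norm_nonneg _)
  have hint : ∀ u, Integrable (fun d => ψ d (inner ℝ u (Φ d))) ν := fun u =>
    integrable_of_abs_le (hψm u) (c := L * κ * ‖u‖) fun d => by
      simpa [hψ0] using hdiff d u 0
  refine (LipschitzWith.of_dist_le_mul (K := (L * κ).toNNReal) fun u u' => ?_).continuous
  rw [Real.dist_eq, ← integral_sub (hint u) (hint u'), dist_eq_norm]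
  refine (norm_integral_le_of_norm_le_const
    (f := fun d => ψ d (inner ℝ u (Φ d)) - ψ d (inner ℝ u' (Φ d))) (C := L * κ * ‖u - u'‖)
    (ae_of_all _ fun d => hdiff d u u')).trans ?_
  simp only [probReal_univ, mul_one]
  exact mul_le_mul_of_nonneg_right (Real.le_coe_toNNReal _) (norm_nonneg _)

/-- Uniform strong law for Lipschitz losses of linear predictors, over balls of radius growing like
`n^{1/4}`: the sixth moments of the deviations are of order `n^{-3/2}`, hence summable. -/
theorem ae_eventually_uniform_deviation_le {X D H Ω : Type*} [TopologicalSpace X]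
    [TopologicalSpace.SeparableSpace X] [MeasurableSpace D] [NormedAddCommGroup H]
    [InnerProductSpace ℝ H]
    {ν : Measure D} [IsProbabilityMeasure ν] {Φ : X → H} (hΦc : Continuous Φ) {κ : ℝ}
    (hΦ : ∀ x, ‖Φ x‖ ≤ κ) {π : D → X} (hΦm : ∀ u, Measurable fun d => inner ℝ u (Φ (π d)))
    {L : ℝ} (hL : 0 ≤ L) {ψ : D → ℝ → ℝ} (hψ0 : ∀ d, ψ d 0 = 0)
    (hψ : ∀ d x y, |ψ d x - ψ d y| ≤ L * |x - y|)
    (hψm : ∀ u, Measurable fun d => ψ d (inner ℝ u (Φ (π d))))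
    [MeasurableSpace Ω] {P : Measure Ω} [IsProbabilityMeasure P] {Z : ℕ → Ω → D}
    (hZ : ∀ i, HasLaw (Z i) ν P) (hind : iIndepFun Z P) {M : ℝ} (hM : 0 ≤ M) :
    ∀ᵐ ω ∂P, ∀ δ > 0, ∀ᶠ n : ℕ in atTop, ∀ u ∈ Submodule.span ℝ (Set.range Φ),
      ‖u‖ ≤ M * (n : ℝ) ^ (1 / 4 : ℝ) →
      ∫ d, ψ d (inner ℝ u (Φ (π d))) ∂ν -
        (∑ j : Fin n, ψ (Z j ω) (inner ℝ u (Φ (π (Z j ω))))) / n ≤ δ := by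
  choose w hwB hwd using fun n : ℕ =>
    exists_dense_seq_ball hΦc (B := M * (n : ℝ) ^ (1 / 4 : ℝ)) (by positivity)
  set U : (n : ℕ) → (Fin n → D) → ℝ := fun n d => ⨆ i, (inner ℝ (w n i) (0 : H) +
    ∑ j, (∫ d', ψ d' (inner ℝ (w n i) (Φ (π d'))) ∂ν -
      ψ (d j) (inner ℝ (w n i) (Φ (π (d j)))))) with hU
  have hterm : ∀ n i, Measurable fun d : Fin n → D => (inner ℝ (w n i) (0 : H) +
      ∑ j, (∫ d', ψ d' (inner ℝ (w n i) (Φ (π d'))) ∂ν -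
        ψ (d j) (inner ℝ (w n i) (Φ (π (d j)))))) := fun n i =>
    (Finset.measurable_sum _ fun j _ =>
      ((hψm (w n i)).comp (measurable_pi_apply j)).const_sub _).const_add _
  have hUm : ∀ n, Measurable fun d => posPartPow (U n d) := fun n =>
    measurable_posPartPow_iSup (hterm n)
  have hsamp : ∀ n : ℕ, AEMeasurable (fun ω (j : Fin n) => Z j ω) P := fun n =>
    aemeasurable_pi_lambda _ fun j => (hZ j).aemeasurable
  -- uniform bound on the summands of the deviation
  have hψb : ∀ u d, |ψ d (inner ℝ u (Φ (π d)))| ≤ L * (‖u‖ * κ) := fun u d => by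
    have h := hψ d (inner ℝ u (Φ (π d))) 0
    rw [hψ0, sub_zero, sub_zero] at h
    exact h.trans (mul_le_mul_of_nonneg_left ((abs_real_inner_le_norm _ _).trans
      (mul_le_mul_of_nonneg_left (hΦ _) (norm_nonneg _))) hL)
  have hκ : ∀ d : D, 0 ≤ κ := fun d => (norm_nonneg _).trans (hΦ (π d))
  have habs : ∀ n (d : Fin n → D) i, |inner ℝ (w n i) (0 : H) +
      ∑ j, (∫ d', ψ d' (inner ℝ (w n i) (Φ (π d'))) ∂ν -
        ψ (d j) (inner ℝ (w n i) (Φ (π (d j)))))| ≤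
      n * (2 * (L * (M * (n : ℝ) ^ (1 / 4 : ℝ) * κ))) := fun n d i => by
    rw [inner_zero_right, zero_add]
    refine (Finset.abs_sum_le_sum_abs _ _).trans ?_
    have : ∀ j ∈ (Finset.univ : Finset (Fin n)), |∫ d', ψ d' (inner ℝ (w n i) (Φ (π d'))) ∂ν -
        ψ (d j) (inner ℝ (w n i) (Φ (π (d j))))| ≤
        2 * (L * (M * (n : ℝ) ^ (1 / 4 : ℝ) * κ)) := fun j _ => by
      have hb : ∀ d, |ψ d (inner ℝ (w n i) (Φ (π d)))| ≤ L * (M * (n : ℝ) ^ (1 / 4 : ℝ) * κ) :=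
        fun d => (hψb _ d).trans (mul_le_mul_of_nonneg_left
          (mul_le_mul_of_nonneg_right (hwB n i) (hκ d)) hL)
      have h := norm_integral_le_of_norm_le_const (μ := ν)
        (f := fun d => ψ d (inner ℝ (w n i) (Φ (π d)))) (ae_of_all _ hb)
      rw [two_mul]
      exact (abs_sub _ _).trans (add_le_add (by simpa using h) (hb _))
    exact (Finset.sum_le_sum this).trans_eq (by simp)
  set c : ℕ → ℝ := fun n => 15 * M ^ 6 * ((2 * L * κ) ^ 2) ^ 3 * (n : ℝ) ^ (-(3 / 2) : ℝ) with hc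
  have hcs : Summable c :=
    (Real.summable_nat_rpow.mpr (by norm_num)).mul_left _
  have hbound : ∀ n : ℕ, ∫⁻ ω, ENNReal.ofReal (posPartPow (U n fun j => Z j ω) / (n : ℝ) ^ 6) ∂P ≤
      ENNReal.ofReal (c n) := fun n => by
    rcases Nat.eq_zero_or_pos n with rfl | hn
    · simp
    have hn' : (0 : ℝ) < n := by exact_mod_cast hn
    have hint : Integrable (fun d => posPartPow (U n d)) (Measure.pi fun _ : Fin n => ν) :=
      integrable_posPartPow_iSup (hterm n) fun i d => habs n d i
    rw [← lintegral_map' (f := fun d => ENNReal.ofReal (posPartPow (U n d) / (n : ℝ) ^ 6))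
      ((hUm n).div_const _).ennreal_ofReal.aemeasurable (hsamp n),
      map_sample_eq_pi hZ hind n, ← ofReal_integral_eq_lintegral_ofReal (hint.div_const _)
        (ae_of_all _ fun d => div_nonneg (posPartPow_nonneg _) (by positivity)), integral_div]
    refine ENNReal.ofReal_le_ofReal ?_
    rw [div_le_iff₀ (by positivity)]
    refine (integral_posPartPow_deviation_le ν (hwB n) (fun d => hΦ (π d)) hΦm hL hψ0 hψ
      (fun i => hψm (w n i)) n 0).trans_eq ?_
    have h6 : ((n : ℝ) ^ (1 / 4 : ℝ)) ^ 6 = (n : ℝ) ^ (-(3 / 2) : ℝ) * (n : ℝ) ^ 3 := by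
      rw [← Real.rpow_natCast, ← Real.rpow_mul hn'.le, ← Real.rpow_natCast (n : ℝ) 3,
        ← Real.rpow_add hn']
      norm_num
    rw [hc, mul_pow, h6, gaussSixth, norm_zero]
    ring
  filter_upwards [ae_tendsto_zero_of_summable
    (fun n => (((hUm n).div_const ((n : ℝ) ^ 6)).comp_aemeasurable (hsamp n)))
    (fun n ω => div_nonneg (posPartPow_nonneg _) (by positivity)) hcs hbound] with ω hω δ hδ
  filter_upwards [hω.eventually_lt_const (pow_pos hδ 6), eventually_gt_atTop 0]
    with n hnδ hn u hu huB
  have hn' : (0 : ℝ) < n := by exact_mod_cast hn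
  have hUδ : U n (fun j => Z j ω) ≤ n * δ := by
    by_contra! hlt
    have h1 : (n * δ) ^ 6 ≤ posPartPow (U n fun j => Z j ω) := by
      unfold posPartPow
      exact pow_le_pow_left₀ (by positivity) (hlt.le.trans (le_max_left _ _)) 6
    have h2 : posPartPow (U n fun j => Z j ω) < δ ^ 6 * (n : ℝ) ^ 6 :=
      (div_lt_iff₀ (by positivity)).mp hnδ
    rw [mul_pow, mul_comm] at h1
    exact absurd h2 (not_lt.mpr h1)
  have hcont : Continuous fun u => ∫ d, ψ d (inner ℝ u (Φ (π d))) ∂ν -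
      (∑ j : Fin n, ψ (Z j ω) (inner ℝ u (Φ (π (Z j ω))))) / n := by
    refine (continuous_integral_inner (fun d => hΦ (π d)) hL hψ0 hψ hψm).sub
      (Continuous.div_const (continuous_finsetSum _ fun j _ => ?_) _)
    have hlip : Continuous (ψ (Z j ω)) :=
      (LipschitzWith.of_dist_le_mul (K := L.toNNReal) fun x y => by
        rw [Real.coe_toNNReal L hL]; exact hψ _ x y).continuous
    exact hlip.comp (continuous_id.inner continuous_const)
  refine closure_minimal ?_ (isClosed_le hcont (continuous_const (y := δ))) (hwd n u hu huB)
  rintro _ ⟨i, rfl⟩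
  have h1 := (le_ciSup (bddAbove_range_of_abs_le (habs n fun j => Z j ω)) i).trans hUδ
  rw [inner_zero_right, zero_add, Finset.sum_sub_distrib, Finset.sum_const, Finset.card_univ,
    Fintype.card_fin, nsmul_eq_mul] at h1
  change _ - _ / _ ≤ δ
  rw [sub_le_iff_le_add, ← sub_le_iff_le_add', le_div_iff₀ hn']
  linarith

/-! ### Strong consistency of clipped kernel ridge regression -/

theorem continuous_featureMap {X H : Type*} [TopologicalSpace X] [NormedAddCommGroup H]
    [InnerProductSpace ℝ H] {k : X → X → ℝ} {Φ : X → H} (hΦ : ∀ x y, inner ℝ (Φ x) (Φ y) = k x y)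
    (hk : Continuous (Function.uncurry k)) : Continuous Φ := by
  refine continuous_iff_continuousAt.mpr fun x₀ => tendsto_iff_norm_sub_tendsto_zero.mpr ?_
  have h1 : ∀ x, ‖Φ x - Φ x₀‖ = √(k x x - 2 * k x x₀ + k x₀ x₀) := fun x => by
    rw [← hΦ, ← hΦ, ← hΦ, real_inner_self_eq_norm_sq, real_inner_self_eq_norm_sq,
      ← norm_sub_sq_real, Real.sqrt_sq (norm_nonneg _)]
  have h2 : Continuous fun x => √(k x x - 2 * k x x₀ + k x₀ x₀) :=
    (((hk.comp (continuous_id.prodMk continuous_id)).sub (continuous_const.mul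
      (hk.comp (continuous_id.prodMk continuous_const)))).add continuous_const).sqrt
  have h3 := h2.tendsto x₀
  simp only [← h1, sub_self, norm_zero] at h3
  exact h3

/-- Truncation of a real number to `[0, M]`. -/
def clip (M t : ℝ) : ℝ := max 0 (min t M)

theorem clip_mono (M : ℝ) : Monotone (clip M) := fun s t h => by
  unfold clip; gcongr

theorem clip_nonneg (M t : ℝ) : 0 ≤ clip M t := le_max_left _ _

theorem clip_le {M : ℝ} (hM : 0 ≤ M) (t : ℝ) : clip M t ≤ M := max_le hM (min_le_right _ _)

theorem clip_zero {M : ℝ} (hM : 0 ≤ M) : clip M 0 = 0 := by simp [clip, hM]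

theorem clip_continuous (M : ℝ) : Continuous (clip M) := by unfold clip; fun_prop

theorem abs_clip_sub_le (M s t : ℝ) : |clip M s - clip M t| ≤ |s - t| := by
  unfold clip
  rw [max_comm 0, max_comm 0]
  exact (abs_max_sub_max_le_abs _ _ _).trans ((abs_min_sub_min_le_max _ _ _ _).trans (by simp))

theorem abs_clip_sub_le_of_mem {M c : ℝ} (t : ℝ) (h0 : 0 ≤ c) (hc : c ≤ M) :
    |clip M t - c| ≤ |t - c| := by
  have : clip M c = c := by simp [clip, h0, hc]
  simpa [this] using abs_clip_sub_le M t c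

/-- The excess over the zero predictor of the clipped square loss with response `c`:
`(clip t - c)² - c²`. -/
def clipLoss (M c t : ℝ) : ℝ := clip M t ^ 2 - 2 * clip M t * c

theorem clipLoss_zero {M : ℝ} (hM : 0 ≤ M) (c : ℝ) : clipLoss M c 0 = 0 := by
  simp [clipLoss, clip_zero hM]

theorem clipLoss_le {M c : ℝ} (t : ℝ) (h0 : 0 ≤ c) (hc : c ≤ M) :
    clipLoss M c t ≤ (t - c) ^ 2 - c ^ 2 := by
  have h1 := sq_le_sq.mpr (abs_clip_sub_le_of_mem t h0 hc)
  unfold clipLoss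
  linarith

theorem abs_clipLoss_sub_le {M c : ℝ} (h0 : 0 ≤ c) (hc : c ≤ M) (s t : ℝ) :
    |clipLoss M c s - clipLoss M c t| ≤ 2 * M * |s - t| := by
  have hM : 0 ≤ M := h0.trans hc
  have h1 : clipLoss M c s - clipLoss M c t =
      (clip M s + clip M t - 2 * c) * (clip M s - clip M t) := by unfold clipLoss; ring
  rw [h1, abs_mul]
  refine mul_le_mul ?_ (abs_clip_sub_le M s t) (abs_nonneg _) (by positivity)
  have := clip_nonneg M s
  have := clip_nonneg M t
  have := clip_le hM s
  have := clip_le hM t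
  exact abs_le.mpr ⟨by linarith, by linarith⟩

/-- Measurable functions with a uniform bound. -/
def IsBoundedMeasurable {X : Type*} [MeasurableSpace X] (a : X → ℝ) : Prop :=
  Measurable a ∧ ∃ c, ∀ x, |a x| ≤ c

theorem IsBoundedMeasurable.integrable {X : Type*} [MeasurableSpace X] {a : X → ℝ}
    (ha : IsBoundedMeasurable a) {μ : Measure X} [IsFiniteMeasure μ] : Integrable a μ :=
  let ⟨h, _, hc⟩ := ha
  integrable_of_abs_le h hc

theorem IsBoundedMeasurable.mul {X : Type*} [MeasurableSpace X] {a b : X → ℝ}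
    (ha : IsBoundedMeasurable a) (hb : IsBoundedMeasurable b) :
    IsBoundedMeasurable fun x => a x * b x := by
  obtain ⟨h, c, hc⟩ := ha
  obtain ⟨h', c', hc'⟩ := hb
  refine ⟨h.mul h', c * c', fun x => ?_⟩
  rw [abs_mul]
  exact mul_le_mul (hc x) (hc' x) (abs_nonneg _) ((abs_nonneg _).trans (hc x))

theorem IsBoundedMeasurable.sub {X : Type*} [MeasurableSpace X] {a b : X → ℝ}
    (ha : IsBoundedMeasurable a) (hb : IsBoundedMeasurable b) :
    IsBoundedMeasurable fun x => a x - b x := by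
  obtain ⟨h, c, hc⟩ := ha
  obtain ⟨h', c', hc'⟩ := hb
  exact ⟨h.sub h', c + c', fun x => (abs_sub _ _).trans (add_le_add (hc x) (hc' x))⟩

theorem IsBoundedMeasurable.const_mul {X : Type*} [MeasurableSpace X] {a : X → ℝ}
    (ha : IsBoundedMeasurable a) (r : ℝ) : IsBoundedMeasurable fun x => r * a x :=
  .mul ⟨measurable_const, |r|, fun _ => le_rfl⟩ ha

theorem IsBoundedMeasurable.comp {X D : Type*} [MeasurableSpace X] [MeasurableSpace D] {a : X → ℝ}
    (ha : IsBoundedMeasurable a) {π : D → X} (hπ : Measurable π) :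
    IsBoundedMeasurable fun d => a (π d) :=
  ⟨ha.1.comp hπ, ha.2.imp fun _ h d => h (π d)⟩

/-- `g` is a regression function of the response `b(s)` on the input `x` under `τ`: a bounded
version of the conditional expectation, tested against bounded measurable functions of `x`. -/
def IsRegression {X E : Type*} [MeasurableSpace X] [MeasurableSpace E] (τ : Measure (X × E))
    (b : E → ℝ) (g : X → ℝ) : Prop :=
  IsBoundedMeasurable g ∧ ∀ a : X → ℝ, IsBoundedMeasurable a →
    ∫ p, a p.1 * b p.2 ∂τ = ∫ x, a x * g x ∂τ.fst

/-- The excess square risk of `a` over the zero predictor, expressed by the distance to the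
regression function. -/
theorem IsRegression.integral_excess {X E : Type*} [MeasurableSpace X] [MeasurableSpace E]
    {τ : Measure (X × E)} [IsProbabilityMeasure τ] {b : E → ℝ} {g : X → ℝ}
    (hg : IsRegression τ b g) (hb : IsBoundedMeasurable b) {a : X → ℝ}
    (ha : IsBoundedMeasurable a) :
    ∫ p, (a p.1 ^ 2 - 2 * a p.1 * b p.2) ∂τ =
      ∫ x, (a x - g x) ^ 2 ∂τ.fst - ∫ x, g x ^ 2 ∂τ.fst := by
  have ha1 := ha.comp (π := (Prod.fst : X × E → X)) measurable_fst
  have hb1 := hb.comp (π := (Prod.snd : X × E → E)) measurable_snd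
  have h1 : ∫ p, (a p.1 ^ 2 - 2 * a p.1 * b p.2) ∂τ =
      ∫ p, a p.1 * a p.1 ∂τ - 2 * ∫ p, a p.1 * b p.2 ∂τ := by
    rw [← integral_const_mul, ← integral_sub (ha1.mul ha1).integrable
      ((ha1.mul hb1).integrable.const_mul 2)]
    exact integral_congr_ae (ae_of_all _ fun p => by ring)
  have h2 : ∫ p, a p.1 * a p.1 ∂τ = ∫ x, a x * a x ∂τ.fst :=
    (integral_map (f := fun x => a x * a x) measurable_fst.aemeasurable
      (ha.mul ha).1.aestronglyMeasurable).symm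
  have h3 : ∫ x, (a x - g x) ^ 2 ∂τ.fst - ∫ x, g x ^ 2 ∂τ.fst =
      ∫ x, a x * a x ∂τ.fst - 2 * ∫ x, a x * g x ∂τ.fst := by
    have i1 : Integrable (fun x => (a x - g x) ^ 2) τ.fst := by
      simpa only [sq] using ((ha.sub hg.1).mul (ha.sub hg.1)).integrable
    have i2 : Integrable (fun x => g x ^ 2) τ.fst := by
      simpa only [sq] using (hg.1.mul hg.1).integrable
    rw [← integral_const_mul, ← integral_sub i1 i2, ← integral_sub (ha.mul ha).integrable
      ((ha.mul hg.1).integrable.const_mul 2)]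
    exact integral_congr_ae (ae_of_all _ fun p => by ring)
  rw [h1, h2, h3, hg.2 a ha]

/-- Universality in terms of a feature map. -/
theorem IsUniversalKernel.exists_inner_near {X H : Type*} [MeasurableSpace X]
    [NormedAddCommGroup H] [InnerProductSpace ℝ H] {k : X → X → ℝ} (hk : IsUniversalKernel k)
    {Φ : X → H} (hΦ : ∀ x y, inner ℝ (Φ x) (Φ y) = k x y)
    (hΦb : ∀ u, IsBoundedMeasurable fun x => inner ℝ u (Φ x)) {μ : Measure X}
    [IsProbabilityMeasure μ] {g : X → ℝ} (hg : IsBoundedMeasurable g) {ε : ℝ} (hε : 0 < ε) :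
    ∃ u : H, ∫ x, (inner ℝ u (Φ x) - g x) ^ 2 ∂μ ≤ ε := by
  have hspan : ∀ h ∈ Submodule.span ℝ (Set.range fun (x' : X) (x : X) => k x x'),
      ∃ u : H, h = fun x => inner ℝ u (Φ x) := fun h hh => by
    induction hh using Submodule.span_induction with
    | mem h hh =>
      obtain ⟨x', rfl⟩ := hh
      exact ⟨Φ x', funext fun x => by rw [real_inner_comm, hΦ]⟩
    | zero => exact ⟨0, funext fun x => by simp⟩
    | add _ _ _ _ h₁ h₂ =>
      obtain ⟨u₁, rfl⟩ := h₁
      obtain ⟨u₂, rfl⟩ := h₂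
      exact ⟨u₁ + u₂, funext fun x => by simp [inner_add_left]⟩
    | smul c _ _ h =>
      obtain ⟨u, rfl⟩ := h
      exact ⟨c • u, funext fun x => by simp [inner_smul_left]⟩
  obtain ⟨cg, hcg⟩ := hg.2
  obtain ⟨h, hh, hlt⟩ := hk μ inferInstance g
    (MemLp.of_bound hg.1.aestronglyMeasurable cg (ae_of_all _ hcg)) (ENNReal.ofReal √ε)
    (by simpa using hε)
  obtain ⟨u, rfl⟩ := hspan h hh
  refine ⟨u, ?_⟩
  obtain ⟨hm, c, hc⟩ := hg.sub (hΦb u)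
  have hL : MemLp (g - fun x => inner ℝ u (Φ x)) 2 μ :=
    MemLp.of_bound hm.aestronglyMeasurable c (ae_of_all _ hc)
  rw [hL.eLpNorm_eq_integral_rpow_norm (by norm_num) (by norm_num),
    ENNReal.ofReal_lt_ofReal_iff (by positivity)] at hlt
  simp only [Pi.sub_apply, ENNReal.toReal_ofNat, Real.rpow_ofNat, Real.norm_eq_abs, sq_abs] at hlt
  rw [← one_div, ← Real.sqrt_eq_rpow] at hlt
  refine le_trans (le_of_eq ?_) (Real.sqrt_lt_sqrt_iff_of_pos hε |>.mp hlt).le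
  exact integral_congr_ae (ae_of_all _ fun x => by ring)

/-- Strong universal consistency: with `λ = n^{-1/2}`, the kernel ridge regressor, clipped to the
range of the response, almost surely converges in `L²` to the regression function. -/
theorem ae_tendsto_integral_clip_ridge {X E Ω : Type*} [TopologicalSpace X] [PolishSpace X]
    [MeasurableSpace X] [BorelSpace X] [MeasurableSpace E] {τ : Measure (X × E)}
    [IsProbabilityMeasure τ] {k : X → X → ℝ} (hk_pd : IsPosDefKernel k)
    (hk_bdd : IsBoundedKernel k) (hk_cont : Continuous (Function.uncurry k))
    (hk_univ : IsUniversalKernel k) [MeasurableSpace Ω] {P : Measure Ω} [IsProbabilityMeasure P]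
    {Z : ℕ → Ω → X × E} (hZ : ∀ i, HasLaw (Z i) τ P) (hind : iIndepFun Z P) {M : ℝ}
    {b : E → ℝ} (hbm : Measurable b) (hb0 : ∀ s, 0 ≤ b s) (hbM : ∀ s, b s ≤ M) (hM : 0 ≤ M)
    {g : X → ℝ} (hg : IsRegression τ b g) :
    ∀ᵐ ω ∂P, Tendsto (fun n : ℕ => ∫ x, (clip M (∑ i : Fin n,
      ridgeWeights k ((n : ℝ) ^ (-(1 / 2) : ℝ)) (fun j : Fin n => (Z j ω).1) x i * b (Z i ω).2)
        - g x) ^ 2 ∂τ.fst) atTop (𝓝 0) := by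
  obtain ⟨H, _, _, Φ, hΦ⟩ := hk_pd.exists_featureMap
  have hΦc := continuous_featureMap hΦ hk_cont
  obtain ⟨C, hC⟩ := hk_bdd
  have hκ : ∀ x, ‖Φ x‖ ≤ √C := fun x => by
    refine Real.le_sqrt_of_sq_le ?_
    rw [← real_inner_self_eq_norm_sq, hΦ]
    exact (le_abs_self _).trans (hC x x)
  have hΦb : ∀ u, IsBoundedMeasurable fun x => inner ℝ u (Φ x) := fun u =>
    ⟨(continuous_const.inner hΦc).measurable, ‖u‖ * √C, fun x =>
      (abs_real_inner_le_norm _ _).trans (mul_le_mul_of_nonneg_left (hκ x) (norm_nonneg _))⟩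
  have hb : IsBoundedMeasurable b :=
    ⟨hbm, M, fun s => abs_le.mpr ⟨by linarith [hb0 s], hbM s⟩⟩
  have hclip : ∀ u, IsBoundedMeasurable fun x => clip M (inner ℝ u (Φ x)) := fun u =>
    ⟨(clip_continuous M).measurable.comp (hΦb u).1, M, fun x =>
      abs_le.mpr ⟨by linarith [clip_nonneg M (inner ℝ u (Φ x))], clip_le hM _⟩⟩
  have hunif := ae_eventually_uniform_deviation_le (ν := τ) hΦc hκ (π := (Prod.fst : X × E → X))
    (fun u => (hΦb u).1.comp measurable_fst) (L := 2 * M) (by positivity)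
    (ψ := fun p t => clipLoss M (b p.2) t) (fun p => clipLoss_zero hM _)
    (fun p => abs_clipLoss_sub_le (hb0 _) (hbM _))
    (fun u => ((hclip u).1.comp measurable_fst).pow_const 2 |>.sub
      ((((hclip u).1.comp measurable_fst).const_mul 2).mul (hbm.comp measurable_snd))) hZ hind hM
  -- A countable family of fixed comparison predictors
  choose u₀ hu₀ using fun m : ℕ => hk_univ.exists_inner_near hΦ hΦb (μ := τ.fst) hg.1
    (ε := 1 / ((m : ℝ) + 1)) (by positivity)
  let q : ℕ → X × E → ℝ := fun m p =>
    inner ℝ (u₀ m) (Φ p.1) ^ 2 - 2 * inner ℝ (u₀ m) (Φ p.1) * b p.2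
  have hqb : ∀ m, IsBoundedMeasurable (q m) := fun m => by
    have h1 := (hΦb (u₀ m)).comp (π := (Prod.fst : X × E → X)) measurable_fst
    have h2 := hb.comp (π := (Prod.snd : X × E → E)) measurable_snd
    have := (h1.mul h1).sub ((h1.const_mul 2).mul h2)
    simpa only [q, sq] using this
  have hlln : ∀ᵐ ω ∂P, ∀ m, Tendsto (fun n : ℕ => (∑ i ∈ Finset.range n, q m (Z i ω)) / n) atTop
      (𝓝 (∫ p, q m p ∂τ)) := by
    refine ae_all_iff.mpr fun m => ?_
    have hid : ∀ i, IdentDistrib (Z i) (Z 0) P P := fun i => by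
      refine ⟨(hZ i).aemeasurable, (hZ 0).aemeasurable, ?_⟩
      rw [(hZ i).map_eq, (hZ 0).map_eq]
    have hint : Integrable (fun ω => q m (Z 0 ω)) P := by
      have : Integrable (q m) (P.map (Z 0)) := by rw [(hZ 0).map_eq]; exact (hqb m).integrable
      exact this.comp_aemeasurable (hZ 0).aemeasurable
    have hmean : ∫ ω, q m (Z 0 ω) ∂P = ∫ p, q m p ∂τ := by
      rw [← (hZ 0).map_eq, integral_map (hZ 0).aemeasurable (hqb m).1.aestronglyMeasurable]
    rw [← hmean]
    exact strong_law_ae_real (fun i ω => q m (Z i ω)) hint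
      (fun i j hij => (hind.indepFun hij).comp (hqb m).1 (hqb m).1)
      fun i => (hid i).comp (hqb m).1
  filter_upwards [hunif, hlln] with ω hω hlω
  refine tendsto_order.mpr ⟨fun a ha => Eventually.of_forall fun n =>
    ha.trans_le (integral_nonneg fun x => sq_nonneg _), fun ε hε => ?_⟩
  obtain ⟨m, hm⟩ := exists_nat_one_div_lt (half_pos hε)
  have hδ : 0 < ε / 8 := by positivity
  have hlam : Tendsto (fun n : ℕ => (n : ℝ) ^ (-(1 / 2) : ℝ) * ‖u₀ m‖ ^ 2) atTop (𝓝 0) := by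
    have := ((tendsto_rpow_neg_atTop (by norm_num : (0 : ℝ) < 1 / 2)).comp
      tendsto_natCast_atTop_atTop).mul_const (‖u₀ m‖ ^ 2)
    simpa using this
  filter_upwards [hω _ hδ, (hlω m).eventually_lt_const (lt_add_of_pos_right _ hδ),
    hlam.eventually_lt_const hδ, eventually_gt_atTop 0] with n hdev hslln hpen hn
  have hn' : (0 : ℝ) < n := by exact_mod_cast hn
  set lam : ℝ := (n : ℝ) ^ (-(1 / 2) : ℝ) with hlamdef
  have hlam0 : 0 < lam := Real.rpow_pos_of_pos hn' _
  obtain ⟨w, hw, hwspan, hmin⟩ := exists_ridge_minimizer hk_pd hΦ (lam := lam)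
    (mul_pos hn' hlam0) (fun j : Fin n => (Z j ω).1) (fun j => b (Z j ω).2)
  simp only [hw]
  -- Comparison with the zero predictor confines the minimizer to a ball of radius `M n^{1/4}`.
  have hwnorm : ‖w‖ ≤ M * (n : ℝ) ^ (1 / 4 : ℝ) := by
    have h1 := hmin 0
    have h2 : ∑ i : Fin n, (inner ℝ (0 : H) (Φ (Z i ω).1) - b (Z i ω).2) ^ 2 ≤ n * M ^ 2 := by
      refine (Finset.sum_le_sum (g := fun _ => M ^ 2) fun i _ => ?_).trans_eq (by simp)
      rw [inner_zero_left, zero_sub, neg_sq]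
      exact pow_le_pow_left₀ (hb0 _) (hbM _) 2
    have h3 : 0 ≤ ∑ i : Fin n, (inner ℝ w (Φ (Z i ω).1) - b (Z i ω).2) ^ 2 :=
      Finset.sum_nonneg fun i _ => sq_nonneg _
    rw [norm_zero] at h1
    have h4 : lam * ‖w‖ ^ 2 ≤ M ^ 2 := by
      have : n * (lam * ‖w‖ ^ 2) ≤ n * M ^ 2 := by linarith
      exact le_of_mul_le_mul_left this hn'
    have h5 : lam * ((n : ℝ) ^ (1 / 4 : ℝ)) ^ 2 = 1 := by
      rw [hlamdef, ← Real.rpow_natCast, ← Real.rpow_mul hn'.le, ← Real.rpow_add hn']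
      norm_num
    refine (sq_le_sq₀ (norm_nonneg _) (by positivity)).mp (le_of_mul_le_mul_left ?_ hlam0)
    rwa [mul_pow, mul_left_comm, h5, mul_one]
  have hdevw := hdev w hwspan hwnorm
  have hemp : ∑ j : Fin n, clipLoss M (b (Z j ω).2) (inner ℝ w (Φ (Z j ω).1)) ≤
      ∑ i ∈ Finset.range n, q m (Z i ω) + n * (lam * ‖u₀ m‖ ^ 2) := by
    have h1 := hmin (u₀ m)
    have h2 : ∑ j : Fin n, clipLoss M (b (Z j ω).2) (inner ℝ w (Φ (Z j ω).1)) ≤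
        ∑ j : Fin n, (inner ℝ w (Φ (Z j ω).1) - b (Z j ω).2) ^ 2 -
          ∑ j : Fin n, b (Z j ω).2 ^ 2 := by
      rw [← Finset.sum_sub_distrib]
      exact Finset.sum_le_sum fun j _ => clipLoss_le _ (hb0 _) (hbM _)
    have h3 : ∑ i ∈ Finset.range n, q m (Z i ω) =
        ∑ j : Fin n, (inner ℝ (u₀ m) (Φ (Z j ω).1) - b (Z j ω).2) ^ 2 -
          ∑ j : Fin n, b (Z j ω).2 ^ 2 := by
      rw [← Finset.sum_sub_distrib, Finset.sum_range]
      exact Finset.sum_congr rfl fun j _ => by ring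
    have h4 : 0 ≤ n * lam * ‖w‖ ^ 2 := by positivity
    linarith
  have hemp' : (∑ j : Fin n, clipLoss M (b (Z j ω).2) (inner ℝ w (Φ (Z j ω).1))) / n ≤
      (∑ i ∈ Finset.range n, q m (Z i ω)) / n + lam * ‖u₀ m‖ ^ 2 := by
    rw [div_add' _ _ _ hn'.ne']
    exact div_le_div_of_nonneg_right (by linarith) hn'.le
  have hex1 := hg.integral_excess hb (hclip w)
  have hex2 := hg.integral_excess hb (hΦb (u₀ m))
  have hu := hu₀ m
  simp only [clipLoss] at hdevw hemp'
  simp only [q] at hslln hemp'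
  linarith

/-! ### The infimum loss and its conditional mean -/

theorem exists_loss_bound {Y : Type*} [Finite Y] (ℓ : Y → Y → ℝ) :
    ∃ M, 0 ≤ M ∧ ∀ z y, ℓ z y ≤ M := by
  obtain ⟨M, hM⟩ := (Set.finite_range (Function.uncurry ℓ)).bddAbove
  exact ⟨max M 0, le_max_right _ _, fun z y => le_max_of_le_left (hM ⟨(z, y), rfl⟩)⟩

theorem ProperLoss.infLoss_nonneg {Y : Type*} {ℓ : Y → Y → ℝ} (hℓ : ProperLoss ℓ) (z : Y)
    (S : Set Y) : 0 ≤ infLoss ℓ z S :=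
  Real.iInf_nonneg fun y => hℓ.1 z y

theorem ProperLoss.bddBelow {Y : Type*} {ℓ : Y → Y → ℝ} (hℓ : ProperLoss ℓ) (z : Y) (S : Set Y) :
    BddBelow (Set.range fun y : S => ℓ z y) :=
  ⟨0, by rintro _ ⟨y, rfl⟩; exact hℓ.1 z y⟩

theorem ProperLoss.infLoss_le {Y : Type*} {ℓ : Y → Y → ℝ} (hℓ : ProperLoss ℓ) {M : ℝ}
    (hM0 : 0 ≤ M) (hM : ∀ z y, ℓ z y ≤ M) (z : Y) (S : Set Y) : infLoss ℓ z S ≤ M := by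
  unfold infLoss
  rcases isEmpty_or_nonempty S with h | ⟨⟨y, hy⟩⟩
  · rwa [Real.iInf_of_isEmpty]
  · exact (ciInf_le (hℓ.bddBelow z S) ⟨y, hy⟩).trans (hM z y)

theorem ProperLoss.infLoss_eq_zero {Y : Type*} {ℓ : Y → Y → ℝ} (hℓ : ProperLoss ℓ) {z : Y}
    {S : Set Y} (hz : z ∈ S) : infLoss ℓ z S = 0 :=
  le_antisymm ((ciInf_le (hℓ.bddBelow z S) ⟨z, hz⟩).trans_eq ((hℓ.2 z z).mpr rfl))
    (hℓ.infLoss_nonneg z S)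

theorem ProperLoss.infLoss_pos {Y : Type*} [Finite Y] {ℓ : Y → Y → ℝ} (hℓ : ProperLoss ℓ) {z : Y}
    {S : Set Y} (hS : S.Nonempty) (hz : z ∉ S) : 0 < infLoss ℓ z S := by
  have : Nonempty S := hS.to_subtype
  obtain ⟨y, hy⟩ := exists_eq_ciInf_of_finite (f := fun y : S => ℓ z y)
  refine (hℓ.infLoss_nonneg z S).lt_of_ne' fun h => hz ?_
  unfold infLoss at h
  rw [← hy, hℓ.2] at h
  exact h ▸ y.2

theorem ProperLoss.isBoundedMeasurable_infLoss {Y : Type*} [Finite Y] [MeasurableSpace Y]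
    {ℓ : Y → Y → ℝ} (hℓ : ProperLoss ℓ) (z : Y) : IsBoundedMeasurable (infLoss ℓ z) := by
  obtain ⟨M, hM0, hM⟩ := exists_loss_bound ℓ
  exact ⟨measurable_of_countable _, M, fun S => abs_le.mpr
    ⟨by linarith [hℓ.infLoss_nonneg z S], hℓ.infLoss_le hM0 hM z S⟩⟩

/-- The conditional mean of the infimum loss of the label `z` given the input `x`. -/
noncomputable def condInfLoss {X Y : Type*} [MeasurableSpace X] [MeasurableSpace Y] [Finite Y]
    (ℓ : Y → Y → ℝ) (τ : Measure (X × Set Y)) [IsFiniteMeasure τ] (z : Y) (x : X) : ℝ :=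
  ∫ S, infLoss ℓ z S ∂(τ.condKernel x)

theorem ProperLoss.isRegression_condInfLoss {X Y : Type*} [MeasurableSpace X] [MeasurableSpace Y]
    [Finite Y] {ℓ : Y → Y → ℝ} (hℓ : ProperLoss ℓ) (τ : Measure (X × Set Y))
    [IsProbabilityMeasure τ] (z : Y) :
    IsRegression τ (infLoss ℓ z) (condInfLoss ℓ τ z) := by
  have hb := hℓ.isBoundedMeasurable_infLoss z
  refine ⟨⟨?_, ?_⟩, fun a ha => ?_⟩
  · exact (StronglyMeasurable.integral_kernel (κ := τ.condKernel)
      hb.1.stronglyMeasurable).measurable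
  · obtain ⟨c, hc⟩ := hb.2
    refine ⟨c, fun x => ?_⟩
    have := norm_integral_le_of_norm_le_const (μ := τ.condKernel x) (f := infLoss ℓ z) (C := c)
      (ae_of_all _ hc)
    simpa [condInfLoss] using this
  · have h1 := (ha.comp (π := (Prod.fst : X × Set Y → X)) measurable_fst).mul
      (hb.comp (π := (Prod.snd : X × Set Y → Set Y)) measurable_snd)
    rw [← Measure.integral_condKernel h1.integrable]
    exact integral_congr_ae (ae_of_all _ fun x => integral_const_mul (a x) (infLoss ℓ z))

/-- A property of the input and the set holds almost surely if and only if it holds for every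
atom of almost every conditional distribution. -/
theorem ae_iff_ae_atoms {X Y : Type*} [MeasurableSpace X] [MeasurableSpace Y] [Finite Y]
    (τ : Measure (X × Set Y)) [IsFiniteMeasure τ] {p : X × Set Y → Prop}
    (hp : MeasurableSet {q | p q}) :
    (∀ᵐ q ∂τ, p q) ↔ ∀ᵐ x ∂τ.fst, ∀ S, τ.condKernel x {S} ≠ 0 → p (x, S) := by
  conv_lhs => rw [← τ.disintegrate τ.condKernel]
  rw [Measure.ae_compProd_iff hp]
  simp only [ae_iff_of_countable]

theorem measurableSet_mem {Y : Type*} [MeasurableSpace Y] [Finite Y]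
    [MeasurableSingletonClass Y] {D : Type*} [MeasurableSpace D] {u : D → Y} {s : D → Set Y}
    (hu : Measurable u) (hs : Measurable s) : MeasurableSet {d | u d ∈ s d} :=
  (hu.prodMk hs) (Set.toFinite {q : Y × Set Y | q.1 ∈ q.2}).measurableSet

/-- If the atoms of `ν` have exactly one common element `y`, then the mean infimum loss vanishes
at `y` and nowhere else. -/
theorem ProperLoss.integral_infLoss_eq_zero_iff {Y : Type*} [Finite Y] [MeasurableSpace Y]
    {ℓ : Y → Y → ℝ} (hℓ : ProperLoss ℓ) {ν : Measure (Set Y)} [IsFiniteMeasure ν] {y : Y}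
    (hν : supportInter ν = {y}) (z : Y) : ∫ S, infLoss ℓ z S ∂ν = 0 ↔ z = y := by
  have hy : ∀ S, ν {S} ≠ 0 → y ∈ S := fun S hS => by
    have : y ∈ supportInter ν := hν ▸ Set.mem_singleton y
    exact this S hS
  rw [integral_eq_zero_iff_of_nonneg (hℓ.infLoss_nonneg z)
    (hℓ.isBoundedMeasurable_infLoss z).integrable]
  constructor
  · intro h
    have h' : ∀ S, ν {S} ≠ 0 → infLoss ℓ z S = 0 := ae_iff_of_countable.mp h
    have : z ∈ supportInter ν := fun S hS => by
      by_contra hz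
      exact (hℓ.infLoss_pos ⟨y, hy S hS⟩ hz).ne' (h' S hS)
    rwa [hν] at this
  · rintro rfl
    exact ae_iff_of_countable.mpr fun S hS => hℓ.infLoss_eq_zero (hy S hS)

/-! ### The distribution of minimum variability -/

theorem isBoundedMeasurable_loss {D Y : Type*} [MeasurableSpace D] [Finite Y] [MeasurableSpace Y]
    [MeasurableSingletonClass Y] (ℓ : Y → Y → ℝ) {u v : D → Y} (hu : Measurable u)
    (hv : Measurable v) : IsBoundedMeasurable fun d => ℓ (u d) (v d) := by
  refine .comp (a := Function.uncurry ℓ) (π := fun d => (u d, v d))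
    ⟨measurable_of_countable _, ?_⟩ (hu.prodMk hv)
  obtain ⟨M, hM⟩ := (Set.finite_range fun q => |Function.uncurry ℓ q|).bddAbove
  exact ⟨M, fun q => hM ⟨q, rfl⟩⟩

theorem ProperLoss.risk_nonneg {X Y : Type*} [MeasurableSpace X] [MeasurableSpace Y]
    {ℓ : Y → Y → ℝ} (hℓ : ProperLoss ℓ) (f : X → Y) (ρ : Measure (X × Y)) : 0 ≤ risk ℓ f ρ :=
  integral_nonneg fun _ => hℓ.1 _ _

/-- A measurable choice of the label common to all possible sets. -/
theorem NonAmbiguous.exists_measurable_label {X Y : Type*} [MeasurableSpace X] [MeasurableSpace Y]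
    [Finite Y] [MeasurableSingletonClass Y] [Nonempty Y] {ℓ : Y → Y → ℝ} (hℓ : ProperLoss ℓ)
    {τ : Measure (X × Set Y)} [IsProbabilityMeasure τ] (hτ : NonAmbiguous τ) :
    ∃ f : X → Y, Measurable f ∧ ∀ᵐ x ∂τ.fst, supportInter (τ.condKernel x) = {f x} := by
  classical
  have hgm : ∀ z, Measurable (condInfLoss ℓ τ z) := fun z => (hℓ.isRegression_condInfLoss τ z).1.1
  let p : X → Prop := fun x => ∃! y, condInfLoss ℓ τ y x = 0
  have hzero : ∀ y, Measurable fun x => condInfLoss ℓ τ y x = 0 := fun y =>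
    measurableSet_setOfPred.mp (hgm y (measurableSet_singleton 0))
  have hp : MeasurableSet {x | p x} := by
    refine measurableSet_setOfPred.mpr (Measurable.exists fun y => (hzero y).and
      (Measurable.forall fun y' => (hzero y').imp measurable_const))
  let y₀ : Y := Classical.arbitrary Y
  let f : X → Y := fun x => if h : p x then h.choose else y₀
  have hf : ∀ x y, p x → (f x = y ↔ condInfLoss ℓ τ y x = 0) := fun x y h => by
    have hc := h.choose_spec
    simp only [f, dif_pos h]
    exact ⟨fun hy => hy ▸ hc.1, fun hy => (hc.2 y hy).symm⟩
  refine ⟨f, measurable_to_countable' fun y => ?_, ?_⟩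
  · have : f ⁻¹' {y} =
        ({x | p x} ∩ {x | condInfLoss ℓ τ y x = 0}) ∪ ({x | p x}ᶜ ∩ {_x | y₀ = y}) := by
      ext x
      by_cases h : p x
      · simp [h, hf x y h]
      · simp [f, h]
    rw [this]
    exact (hp.inter (measurableSet_setOfPred.mpr (hzero y))).union (hp.compl.inter (.const _))
  · filter_upwards [hτ] with x ⟨y, hy⟩
    have hiff : ∀ z, condInfLoss ℓ τ z x = 0 ↔ z = y := hℓ.integral_infLoss_eq_zero_iff hy
    have hpx : p x := ⟨y, (hiff y).mpr rfl, fun z hz => (hiff z).mp hz⟩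
    rw [(hf x y hpx).mpr ((hiff y).mpr rfl), hy]

/-- Under non-ambiguity the minimum variability is zero: labelling every input by the common label
is eligible and deterministic. -/
theorem IsMinVariability.minRisk_nonpos {X Y : Type*} [MeasurableSpace X] [MeasurableSpace Y]
    [Finite Y] [MeasurableSingletonClass Y] [Nonempty Y] {ℓ : Y → Y → ℝ} (hℓ : ProperLoss ℓ)
    {τ : Measure (X × Set Y)} [IsProbabilityMeasure τ] (hτ : NonAmbiguous τ)
    {ρ : Measure (X × Y)} (hρ : IsMinVariability ℓ τ ρ) : minRisk ℓ ρ ≤ 0 := by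
  obtain ⟨f, hfm, hf⟩ := hτ.exists_measurable_label hℓ
  have hm1 : Measurable fun p : X × Set Y => (p.1, f p.1, p.2) := by fun_prop
  have hm2 : Measurable fun p : X × Set Y => (p.1, f p.1) := by fun_prop
  have hmem : MeasurableSet {q : X × Set Y | f q.1 ∈ q.2} :=
    measurableSet_mem (hfm.comp measurable_fst) measurable_snd
  have hel : Eligible (τ.map fun p => (p.1, f p.1)) τ := by
    refine ⟨τ.map fun p => (p.1, f p.1, p.2), Measure.isProbabilityMeasure_map hm1.aemeasurable,
      ?_, ?_, ?_⟩
    · rw [Measure.map_map (by fun_prop) hm1]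
      rfl
    · rw [Measure.map_map (by fun_prop) hm1]
      exact Measure.map_id
    · have hms : MeasurableSet {p : X × Y × Set Y | p.2.1 ∉ p.2.2} :=
        (measurableSet_mem (by fun_prop) (by fun_prop)).compl
      rw [Measure.map_apply hm1 hms]
      refine (ae_iff_ae_atoms τ hmem).mpr ?_
      filter_upwards [hf] with x hx S hS
      have : f x ∈ supportInter (τ.condKernel x) := hx ▸ Set.mem_singleton _
      exact this S hS
  have hrisk : risk ℓ f (τ.map fun p => (p.1, f p.1)) = 0 := by
    unfold risk
    rw [integral_map hm2.aemeasurable (isBoundedMeasurable_loss ℓ (u := fun p : X × Y => f p.1)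
      (hfm.comp measurable_fst) measurable_snd).1.aestronglyMeasurable]
    simp [(hℓ.2 _ _).mpr rfl]
  refine (hρ.2 _ hel).trans ((ciInf_le ⟨0, ?_⟩ ⟨f, hfm⟩).trans_eq hrisk)
  rintro _ ⟨f, rfl⟩
  exact hℓ.risk_nonneg _ _

/-- Under non-ambiguity, a risk minimizer for a distribution of minimum variability has zero risk,
hence recovers the label, which is the one common to all possible sets. -/
theorem IsMinVariability.label_eq {X Y : Type*} [MeasurableSpace X] [MeasurableSpace Y]
    [Finite Y] [MeasurableSingletonClass Y] {ℓ : Y → Y → ℝ} (hℓ : ProperLoss ℓ)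
    {τ : Measure (X × Set Y)} [IsProbabilityMeasure τ] (hτ : NonAmbiguous τ)
    {ρ : Measure (X × Y)} (hρ : IsMinVariability ℓ τ ρ) {f : X → Y} (hf : IsRiskMinimizer ℓ ρ f) :
    ρ.fst = τ.fst ∧ risk ℓ f ρ = 0 ∧ (∀ᵐ p ∂ρ, p.2 = f p.1) ∧
      ∀ᵐ x ∂τ.fst, supportInter (τ.condKernel x) = {f x} := by
  obtain ⟨π, hπ, hπρ, hπτ, hπ0⟩ := hρ.1
  have : Nonempty Y := (nonempty_of_isProbabilityMeasure π).map fun p => p.2.1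
  have hm1 : Measurable fun p : X × Y × Set Y => (p.1, p.2.1) := by fun_prop
  have hm2 : Measurable fun p : X × Y × Set Y => (p.1, p.2.2) := by fun_prop
  have hρprob : IsProbabilityMeasure ρ := hπρ ▸ Measure.isProbabilityMeasure_map hm1.aemeasurable
  have hfst : ρ.fst = τ.fst := by
    rw [Measure.fst, Measure.fst, ← hπρ, ← hπτ, Measure.map_map measurable_fst hm1,
      Measure.map_map measurable_fst hm2]
    rfl
  have : Nonempty {f : X → Y // Measurable f} := ⟨⟨f, hf.1⟩⟩
  have hmin : risk ℓ f ρ ≤ minRisk ℓ ρ := le_ciInf fun g => hf.2 g.1 g.2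
  have hrisk : risk ℓ f ρ = 0 :=
    le_antisymm (hmin.trans (hρ.minRisk_nonpos hℓ hτ)) (hℓ.risk_nonneg f ρ)
  have hlabel : ∀ᵐ p ∂ρ, p.2 = f p.1 := by
    have h := (integral_eq_zero_iff_of_nonneg (fun p : X × Y => hℓ.1 (f p.1) p.2)
      (isBoundedMeasurable_loss ℓ (hf.1.comp measurable_fst) measurable_snd).integrable).mp hrisk
    filter_upwards [h] with p hp
    exact ((hℓ.2 _ _).mp hp).symm
  have hπlabel : ∀ᵐ p ∂π, p.2.1 = f p.1 := by
    rw [← hπρ] at hlabel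
    exact ae_of_ae_map hm1.aemeasurable hlabel
  have hmem : ∀ᵐ q ∂τ, f q.1 ∈ q.2 := by
    rw [← hπτ]
    refine (ae_map_iff hm2.aemeasurable
      (measurableSet_mem (hf.1.comp measurable_fst) measurable_snd)).mpr ?_
    filter_upwards [hπlabel, (ae_iff.mpr hπ0 : ∀ᵐ p ∂π, p.2.1 ∈ p.2.2)] with p h1 h2
    rwa [h1] at h2
  refine ⟨hfst, hrisk, hlabel, ?_⟩
  filter_upwards [hτ, (ae_iff_ae_atoms τ (measurableSet_mem (hf.1.comp measurable_fst)
    measurable_snd)).mp hmem] with x ⟨y, hy⟩ hx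
  have : f x ∈ supportInter (τ.condKernel x) := fun S hS => hx S hS
  rw [hy] at this ⊢
  rw [Set.mem_singleton_iff.mp this]

/-! ### From regression to classification -/

theorem exists_measureReal_le_of_ae_pos {X : Type*} [MeasurableSpace X] {μ : Measure X}
    [IsFiniteMeasure μ] {h : X → ℝ} (hm : Measurable h) (hpos : ∀ᵐ x ∂μ, 0 < h x) {ε : ℝ}
    (hε : 0 < ε) : ∃ δ > 0, μ.real {x | h x ≤ δ} < ε := by
  have hlim : Tendsto (fun m : ℕ => μ {x | h x ≤ 1 / ((m : ℝ) + 1)}) atTop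
      (𝓝 (μ (⋂ m : ℕ, {x | h x ≤ 1 / ((m : ℝ) + 1)}))) := by
    refine tendsto_measure_iInter_atTop (fun m => (hm measurableSet_Iic).nullMeasurableSet)
      (fun m m' hmm x (hx : h x ≤ _) => (hx.trans ?_ : h x ≤ _)) ⟨0, measure_ne_top _ _⟩
    exact one_div_le_one_div_of_le (by positivity) (by gcongr)
  have hzero : μ (⋂ m : ℕ, {x | h x ≤ 1 / ((m : ℝ) + 1)}) = 0 := by
    refine measure_mono_null (fun x hx => ?_) (ae_iff.mp hpos)
    rw [Set.mem_iInter] at hx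
    exact not_lt.mpr (ge_of_tendsto' tendsto_one_div_add_atTop_nhds_zero_nat hx)
  rw [hzero] at hlim
  have h2 := (ENNReal.tendsto_toReal ENNReal.zero_ne_top).comp hlim
  obtain ⟨m, hm⟩ := (h2.eventually_lt_const (by simpa using hε)).exists
  exact ⟨1 / ((m : ℝ) + 1), by positivity, hm⟩

/-- If square-integral approximations `r n z` of the functions `g z` converge, and `F n x`
minimizes `r n · x`, then `F n` converges in measure to the unique zero `F' x` of the nonnegative
functions `g · x`. -/
theorem tendsto_measureReal_argmin_ne {X Y : Type*} [MeasurableSpace X] {μ : Measure X}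
    [IsFiniteMeasure μ] [Finite Y] [MeasurableSpace Y] [MeasurableSingletonClass Y] [Nonempty Y]
    {g : Y → X → ℝ} (hg : ∀ z, Measurable (g z)) (hg0 : ∀ z x, 0 ≤ g z x) {F' : X → Y}
    (hF'm : Measurable F') (hF' : ∀ᵐ x ∂μ, ∀ z, g z x = 0 ↔ z = F' x) {r : ℕ → Y → X → ℝ}
    (hri : ∀ n z, Integrable (fun x => (r n z x - g z x) ^ 2) μ)
    (hr : ∀ z, Tendsto (fun n => ∫ x, (r n z x - g z x) ^ 2 ∂μ) atTop (𝓝 0)) {F : ℕ → X → Y}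
    (hF : ∀ n x z, r n (F n x) x ≤ r n z x) :
    Tendsto (fun n => μ.real {x | F n x ≠ F' x}) atTop (𝓝 0) := by
  classical
  have := Fintype.ofFinite Y
  -- The margin: the least value of `g z x` over the labels `z ≠ F' x`, capped at one.
  set gap : X → ℝ := fun x => ⨅ z, if z = F' x then 1 else g z x with hgap
  have hgapm : Measurable gap := Measurable.iInf fun z =>
    Measurable.ite (measurableSet_eq_fun measurable_const hF'm) measurable_const (hg z)
  have hgap_pos : ∀ᵐ x ∂μ, 0 < gap x := by
    filter_upwards [hF'] with x hx
    obtain ⟨z, hz⟩ := exists_eq_ciInf_of_finite (f := fun z => if z = F' x then 1 else g z x)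
    rw [hgap]
    simp only
    rw [← hz]
    split_ifs with h
    · exact one_pos
    · exact (hg0 z x).lt_of_ne' fun h0 => h ((hx z).mp h0)
  have hgap_le : ∀ x z, z ≠ F' x → gap x ≤ g z x := fun x z hz => by
    have := ciInf_le (Set.finite_range fun z => if z = F' x then (1 : ℝ) else g z x).bddBelow z
    simpa [hz] using this
  set e : ℕ → X → ℝ := fun n x => ∑ z, (r n z x - g z x) ^ 2 with he
  have hei : ∀ n, Integrable (e n) μ := fun n => integrable_finsetSum _ fun z _ => hri n z
  have he0 : ∀ n x, 0 ≤ e n x := fun n x => Finset.sum_nonneg fun z _ => sq_nonneg _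
  have helim : Tendsto (fun n => ∫ x, e n x ∂μ) atTop (𝓝 0) := by
    have h1 : ∀ n, ∫ x, e n x ∂μ = ∑ z, ∫ x, (r n z x - g z x) ^ 2 ∂μ := fun n =>
      integral_finsetSum _ fun z _ => hri n z
    simp only [h1]
    simpa using tendsto_finsetSum Finset.univ fun z _ => hr z
  refine tendsto_order.mpr ⟨fun a ha => Eventually.of_forall fun n =>
    ha.trans_le measureReal_nonneg, fun ε hε => ?_⟩
  obtain ⟨δ, hδ, hδε⟩ := exists_measureReal_le_of_ae_pos hgapm hgap_pos (half_pos hε)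
  have hη : 0 < (δ / 2) ^ 2 := by positivity
  have hsub : ∀ n, ∀ᵐ x ∂μ, x ∈ {x | F n x ≠ F' x} →
      x ∈ {x | gap x ≤ δ} ∪ {x | (δ / 2) ^ 2 ≤ e n x} := fun n => by
    filter_upwards [hF'] with x hx hne
    rw [Set.mem_union, or_iff_not_imp_left]
    intro hgt
    have hgt' : δ < gap x := not_le.mp hgt
    change (δ / 2) ^ 2 ≤ e n x
    by_contra! hlt
    have habs : ∀ z, |r n z x - g z x| < δ / 2 := fun z => by
      refine lt_of_pow_lt_pow_left₀ 2 (by positivity) ?_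
      rw [sq_abs]
      exact (Finset.single_le_sum (f := fun z => (r n z x - g z x) ^ 2)
        (fun z _ => sq_nonneg _) (Finset.mem_univ z)).trans_lt hlt
    have h1 := hgap_le x (F n x) hne
    have h2 := (hx (F' x)).mpr rfl
    linarith [(abs_lt.mp (habs (F n x))).1, (abs_lt.mp (habs (F' x))).2, hF n x (F' x)]
  filter_upwards [helim.eventually_lt_const (mul_pos hη (half_pos hε))] with n hn
  have hmarkov := mul_meas_ge_le_integral_of_nonneg (ae_of_all _ (he0 n)) (hei n) ((δ / 2) ^ 2)
  calc μ.real {x | F n x ≠ F' x}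
      ≤ μ.real ({x | gap x ≤ δ} ∪ {x | (δ / 2) ^ 2 ≤ e n x}) :=
        ENNReal.toReal_mono (measure_ne_top _ _) (measure_mono_ae (hsub n))
    _ ≤ μ.real {x | gap x ≤ δ} + μ.real {x | (δ / 2) ^ 2 ≤ e n x} := measureReal_union_le _ _
    _ < ε := by
        have : μ.real {x | (δ / 2) ^ 2 ≤ e n x} < ε / 2 :=
          lt_of_mul_lt_mul_left (hmarkov.trans_lt hn) hη.le
        linarith

theorem measurable_score {X Y : Type*} [TopologicalSpace X] [MeasurableSpace X]
    [OpensMeasurableSpace X] (ℓ : Y → Y → ℝ) {k : X → X → ℝ}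
    (hk : Continuous (Function.uncurry k)) (lam : ℝ) {n : ℕ} (data : Fin n → X × Set Y) (z : Y) :
    Measurable fun x => score ℓ k lam data x z := by
  refine Continuous.measurable <|
    continuous_finsetSum _ fun i _ => Continuous.mul ?_ continuous_const
  simp only [ridgeWeights, Matrix.mulVec, dotProduct]
  exact continuous_finsetSum _ fun j _ => continuous_const.mul
    (hk.comp (continuous_id.prodMk continuous_const))

/-- When the label is a function `f'` of the input, the risk is controlled by the probability of
disagreement with `f'`. -/
theorem risk_le_mul_measureReal_ne {X Y : Type*} [MeasurableSpace X] [MeasurableSpace Y] [Finite Y]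
    [MeasurableSingletonClass Y] {ℓ : Y → Y → ℝ} (hℓ : ProperLoss ℓ) {M : ℝ}
    (hM : ∀ z y, ℓ z y ≤ M) {ρ : Measure (X × Y)} [IsProbabilityMeasure ρ] {μ : Measure X}
    (hρμ : ρ.fst = μ) {f f' : X → Y} (hlabel : ∀ᵐ p ∂ρ, p.2 = f' p.1) (hf : Measurable f)
    (hf' : Measurable f') : risk ℓ f ρ ≤ M * μ.real {x | f x ≠ f' x} := by
  have hA : MeasurableSet {x | f x ≠ f' x} := (measurableSet_eq_fun hf hf').compl
  have hA' : MeasurableSet {p : X × Y | f p.1 ≠ f' p.1} := measurable_fst hA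
  have hle : ∀ᵐ p ∂ρ, ℓ (f p.1) p.2 ≤ {p : X × Y | f p.1 ≠ f' p.1}.indicator (fun _ => M) p := by
    filter_upwards [hlabel] with p hp
    by_cases h : f p.1 = f' p.1
    · rw [Set.indicator_of_notMem (by simpa using h), hp, h, (hℓ.2 _ _).mpr rfl]
    · rw [Set.indicator_of_mem (by simpa using h)]
      exact hM _ _
  refine (integral_mono_ae (isBoundedMeasurable_loss ℓ (u := fun p : X × Y => f p.1)
    (hf.comp measurable_fst) measurable_snd).integrable
    ((integrable_const M).indicator hA') hle).trans_eq ?_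
  rw [integral_indicator_const _ hA', smul_eq_mul, mul_comm, ← hρμ, measureReal_def,
    measureReal_def, Measure.fst_apply hA]
  rfl

end PartialLabelling

open PartialLabelling in
theorem theorem3
    {X : Type*} [TopologicalSpace X] [PolishSpace X] [MeasurableSpace X] [BorelSpace X]
    {Y : Type*} [Finite Y] [MeasurableSpace Y] [MeasurableSingletonClass Y]
    (ℓ : Y → Y → ℝ) (hℓ : ProperLoss ℓ)
    (τ : Measure (X × Set Y)) [IsProbabilityMeasure τ] (hτ : NonAmbiguous τ)
    (k : X → X → ℝ) (hk_pd : IsPosDefKernel k) (hk_bdd : IsBoundedKernel k)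
    (hk_cont : Continuous (Function.uncurry k)) (hk_univ : IsUniversalKernel k)
    (ρstar : Measure (X × Y)) (hρstar : IsMinVariability ℓ τ ρstar)
    (fstar : X → Y) (hfstar : IsRiskMinimizer ℓ ρstar fstar)
    {Ω : Type*} [MeasurableSpace Ω] (P : Measure Ω) [IsProbabilityMeasure P]
    (Z : ℕ → Ω → X × Set Y) (hZ_law : ∀ i, HasLaw (Z i) τ P) (hZ_indep : iIndepFun Z P)
    (f : ℕ → Ω → X → Y)
    (hf : ∀ (n : ℕ) (ω : Ω),
      IsEstimator ℓ k ((n : ℝ) ^ (-(1 / 2) : ℝ)) (fun i : Fin n => Z i ω) (f n ω)) :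
    ∀ᵐ ω ∂P, Tendsto (fun n => risk ℓ (f n ω) ρstar) atTop (𝓝 (risk ℓ fstar ρstar)) := by
  obtain ⟨hfst, hrisk, hlabel, hinter⟩ := hρstar.label_eq hℓ hτ hfstar
  obtain ⟨M, hM0, hM⟩ := exists_loss_bound ℓ
  have hreg := fun z => hℓ.isRegression_condInfLoss τ z
  have hcons : ∀ᵐ ω ∂P, ∀ z, Tendsto (fun n : ℕ => ∫ x, (clip M (score ℓ k
      ((n : ℝ) ^ (-(1 / 2) : ℝ)) (fun i : Fin n => Z i ω) x z) - condInfLoss ℓ τ z x) ^ 2 ∂τ.fst)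
      atTop (𝓝 0) :=
    ae_all_iff.mpr fun z => ae_tendsto_integral_clip_ridge hk_pd hk_bdd hk_cont hk_univ hZ_law
      hZ_indep (hℓ.isBoundedMeasurable_infLoss z).1 (hℓ.infLoss_nonneg z)
      (hℓ.infLoss_le hM0 hM z) hM0 (hreg z)
  have hzero : ∀ᵐ x ∂τ.fst, ∀ z, condInfLoss ℓ τ z x = 0 ↔ z = fstar x := by
    filter_upwards [hinter] with x hx using hℓ.integral_infLoss_eq_zero_iff hx
  filter_upwards [hcons] with ω hω
  have hρ : IsProbabilityMeasure ρstar := by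
    obtain ⟨π, hπ, hπρ, -⟩ := hρstar.1
    rw [← hπρ]
    exact Measure.isProbabilityMeasure_map (by fun_prop)
  have : Nonempty Y := (nonempty_of_isProbabilityMeasure ρstar).map Prod.snd
  have hconv := tendsto_measureReal_argmin_ne (fun z => (hreg z).1.1)
    (fun z x => integral_nonneg (hℓ.infLoss_nonneg z)) hfstar.1 hzero
    (fun n z => by
      have hb : IsBoundedMeasurable fun x => clip M (score ℓ k
          ((n : ℝ) ^ (-(1 / 2) : ℝ)) (fun i : Fin n => Z i ω) x z) :=
        ⟨(clip_continuous M).measurable.comp (measurable_score ℓ hk_cont _ _ z), M, fun x =>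
          abs_le.mpr ⟨by linarith [clip_nonneg M (score ℓ k ((n : ℝ) ^ (-(1 / 2) : ℝ))
            (fun i : Fin n => Z i ω) x z)], clip_le hM0 _⟩⟩
      simpa only [sq] using ((hb.sub (hreg z).1).mul (hb.sub (hreg z).1)).integrable) hω
    (fun n x z => clip_mono M ((hf n ω).2 x z))
  rw [hrisk]
  refine squeeze_zero (fun n => hℓ.risk_nonneg _ _) (fun n => ?_)
    (by simpa using hconv.const_mul M)
  exact risk_le_mul_measureReal_ne hℓ hM hfst hlabel (hf n ω).1 hfstar.1
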